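/- Let $\dot{\mathfrak g}$ be a finite-dimensional simple Lie algebra over $\mathbb C$ with a nondegenerate invariant symmetric bilinear form $(\cdot|\cdot)$, let $\dot{\mathfrak h}$ be a Cartan subalgebra, $\dot\Delta$ the root system, $\dot\Delta_+$ the positive roots with respect to a chosen base, and $\dot{\mathfrak g}_+=\bigoplus_{\alpha\in\dot\Delta_+}\dot{\mathfrak g}_\alpha$. Let $\nu\ge 1$, $A=\mathbb C[t_0^{\pm1},\dots,t_\nu^{\pm1}]$, and let $\tau=\dot{\mathfrak g}\otimes A\oplus\mathcal K\oplus\mathcal D$ be the full toroidal Lie algebra. Here $\mathcal K$ is spanned by the $t^{\mathbf r}k_p$ ($\mathbf r\in\mathbb Z^{\nu+1}$, $0\le p\le\nu$) subject to $\sum_p r_p t^{\mathbf r}k_p=0$, $\mathcal D=\operatorname{Der}A$ has basis $t^{\mathbf m}d_a$ with $d_a=t_a\,\partial/\partial t_a$, and the bracket is given by $[\dot{\mathfrak g}\otimes A\oplus\mathcal K,\mathcal K]=0$ and $$[x\otimes t^{\mathbf m},y\otimes t^{\mathbf n}]=[x,y]\otimes t^{\mathbf m+\mathbf n}+(x|y)\sum_p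 m_p t^{\mathbf m+\mathbf n}k_p,\qquad [t^{\mathbf m}d_a,x\otimes t^{\mathbf n}]=n_a\,x\otimes t^{\mathbf m+\mathbf n},$$ $$[t^{\mathbf m}d_a,t^{\mathbf n}k_b]=n_a t^{\mathbf m+\mathbf n}k_b+\delta_{ab}\sum_p m_p t^{\mathbf m+\mathbf n}k_p,$$ $$[t^{\mathbf m}d_a,t^{\mathbf n}d_b]=n_a t^{\mathbf m+\mathbf n}d_b-m_b t^{\mathbf m+\mathbf n}d_a+(-c_1 n_a m_b+c_2 m_a n_b)\sum_p m_p t^{\mathbf m+\mathbf n}k_p,$$ with arbitrary fixed $c_1,c_2\in\mathbb C$. Let $B$ be a finitely generated commutative associative unital $\mathbb C$-algebra and $\tau(B)=\tau\otimes B$ with $[X\otimes b,Y\otimes b']=[X,Y]\otimes bb'$. Put $\mathfrak h=\dot{\mathfrak h}\oplus\bigoplus_i\mathbb Ck_i\oplus\bigoplus_i\mathbb Cd_i$. Let $V$ be an irreducible integrable $\tau(B)$-module with finite-dimensional weight spaces: $V$ is the direct sum of its weight spaces $V_\lambda$ ($\lambda\in\mathfrak h^*$) for $\mathfrak h\otimes1$,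 every $V_\lambda$ is finite-dimensional, and for all $\alpha\in\dot\Delta$, $x\in\dot{\mathfrak g}_\alpha$, $\mathbf m\in\mathbb Z^{\nu+1}$ and $b\in B$ the element $x\otimes t^{\mathbf m}\otimes b$ acts locally nilpotently on $V$. Suppose that the central charges are zero, i.e. $k_i\otimes1$ acts as $0$ on $V$ for $0\le i\le\nu$, and that $(\dot{\mathfrak g}\otimes A\otimes B)\cdot V\neq0$. Let $$T=\{v\in V\mid(\dot{\mathfrak g}_+\otimes A\otimes B)\cdot v=0\}.$$ Then there is a unital $\mathbb C$-algebra homomorphism $\psi:B\to\mathbb C$ such that, for all $\mathbf m\in\mathbb Z^{\nu+1}$, $b\in B$ and $v\in T$, $$h\otimes t^{\mathbf m}\otimes b\cdot v=\psi(b)\,h\otimes t^{\mathbf m}\otimes1\cdot v\quad\text{for all }h\in\dot{\mathfrak h},$$ $$x_{-\alpha}\otimes t^{\mathbf m}\otimes b\cdot v=\psi(b)\,x_{-\alpha}\otimes t^{\mathbf m}\otimes1\cdot v\quad\text{for all }\alpha\in\dot\Delta_+\text{ and }x_{-\alpha}\in\dot{\mathfrak g}_{-\alpha}.$$ -/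

import Mathlib

open scoped TensorProduct

namespace FullToroidal

/-- Exponents `m = (m₀, …, m_ν)` of the Laurent monomials
`t^m = t₀^{m₀} ⋯ t_ν^{m_ν}` in `A = ℂ[t₀^{±1}, …, t_ν^{±1}]`. -/
abbrev Deg (ν : ℕ) : Type := Fin (ν + 1) → ℤ

/-- A nondegenerate invariant symmetric bilinear form `(· | ·)` on `𝔤`. -/
structure InvariantForm (𝔤 : Type*) [LieRing 𝔤] [LieAlgebra ℂ 𝔤] where
  form : LinearMap.BilinForm ℂ 𝔤
  symm : ∀ x y, form x y = form y x
  invariant : ∀ x y z, form ⁅x, y⁆ z = form x ⁅y, z⁆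
  nondegenerate : form.Nondegenerate

/-- The loop part `𝔤 ⊗ A`: the element `x ⊗ t^m` is `Finsupp.single m x`. -/
abbrev Loop (𝔤 : Type*) [LieRing 𝔤] (ν : ℕ) : Type _ := Deg ν →₀ 𝔤

/-- The derivation algebra `𝒟` of `A`, which is free over `A` on `d_a = t_a ∂/∂t_a`: its basis
element `t^m d_a` is `Finsupp.single (m, a) 1`. -/
abbrev DerA (ν : ℕ) : Type := (Deg ν × Fin (ν + 1)) →₀ ℂ

/-- The relations `∑ₚ rₚ t^r kₚ = 0` imposed on the symbols `t^r kₚ`. -/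
noncomputable def centralRel (ν : ℕ) : Submodule ℂ ((Deg ν × Fin (ν + 1)) →₀ ℂ) :=
  Submodule.span ℂ
    (Set.range fun r : Deg ν => ∑ p : Fin (ν + 1), Finsupp.single (r, p) ((r p : ℤ) : ℂ))

/-- The space `𝒦`, spanned by the `t^r kₚ` subject to `∑ₚ rₚ t^r kₚ = 0`. -/
abbrev Central (ν : ℕ) : Type := ((Deg ν × Fin (ν + 1)) →₀ ℂ) ⧸ centralRel ν

section Pieces

set_option linter.unusedSectionVars false

variable {𝔤 : Type*} [LieRing 𝔤] [LieAlgebra ℂ 𝔤] {ν : ℕ}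

/-- `t^m d_a ∈ 𝒟`. -/
noncomputable def dmon (m : Deg ν) (a : Fin (ν + 1)) : DerA ν := Finsupp.single (m, a) 1

/-- `t^m kₚ ∈ 𝒦`. -/
noncomputable def kmon (m : Deg ν) (p : Fin (ν + 1)) : Central ν :=
  Submodule.Quotient.mk (Finsupp.single (m, p) 1)

/-- `∑ₚ uₚ t^s kₚ ∈ 𝒦`. -/
noncomputable def ksum (s u : Deg ν) : Central ν :=
  ∑ p : Fin (ν + 1), ((u p : ℤ) : ℂ) • kmon s p

theorem ksum_self (s : Deg ν) : ksum s s = 0 := by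
  have h : (∑ p : Fin (ν + 1), Finsupp.single (s, p) ((s p : ℤ) : ℂ)) ∈ centralRel ν :=
    Submodule.subset_span ⟨s, rfl⟩
  rw [← Submodule.Quotient.mk_eq_zero] at h
  rw [← h, ksum]
  change _ = (centralRel ν).mkQ _
  rw [map_sum]
  refine Finset.sum_congr rfl fun p _ => ?_
  change _ • (centralRel ν).mkQ _ = _
  rw [← map_smul, Finsupp.smul_single, smul_eq_mul, mul_one]

theorem ksum_add (s u v : Deg ν) : ksum s (u + v) = ksum s u + ksum s v := by
  simp [ksum, add_smul, Finset.sum_add_distrib]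

/-- Bracket of the loop algebra: `[x ⊗ t^m, y ⊗ t^n] = [x, y] ⊗ t^{m+n}`. -/
noncomputable def loopBr : Loop 𝔤 ν →ₗ[ℂ] Loop 𝔤 ν →ₗ[ℂ] Loop 𝔤 ν :=
  Finsupp.lsum ℂ fun m =>
    LinearMap.flip <| Finsupp.lsum ℂ fun n =>
      LinearMap.flip <|
        (LieModule.toEnd ℂ 𝔤 𝔤 : 𝔤 →ₗ[ℂ] Module.End ℂ 𝔤).compr₂ (Finsupp.lsingle (m + n))

/-- The central term `(x ⊗ t^m, y ⊗ t^n) ↦ (x | y) ∑ₚ mₚ t^{m+n} kₚ`. -/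
noncomputable def kappa (Φ : InvariantForm 𝔤) : Loop 𝔤 ν →ₗ[ℂ] Loop 𝔤 ν →ₗ[ℂ] Central ν :=
  Finsupp.lsum ℂ fun m =>
    LinearMap.flip <| Finsupp.lsum ℂ fun n =>
      LinearMap.flip <| Φ.form.compr₂ ((LinearMap.id : ℂ →ₗ[ℂ] ℂ).smulRight (ksum (m + n) m))

/-- Action of `𝒟` on the loop algebra: `(t^m d_a)(x ⊗ t^n) = n_a x ⊗ t^{m+n}`. -/
noncomputable def derLoop : DerA ν →ₗ[ℂ] Loop 𝔤 ν →ₗ[ℂ] Loop 𝔤 ν :=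
  Finsupp.linearCombination ℂ fun i : Deg ν × Fin (ν + 1) =>
    Finsupp.lsum ℂ fun n => ((n i.2 : ℤ) : ℂ) • Finsupp.lsingle (i.1 + n)

/-- Action of `𝒟` on the symbols `t^n k_b`:
`(t^m d_a)(t^n k_b) = n_a t^{m+n} k_b + δ_{ab} ∑ₚ mₚ t^{m+n} kₚ`. -/
noncomputable def derCentralAux (m : Deg ν) (a : Fin (ν + 1)) :
    ((Deg ν × Fin (ν + 1)) →₀ ℂ) →ₗ[ℂ] Central ν :=
  Finsupp.linearCombination ℂ fun j : Deg ν × Fin (ν + 1) =>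
    ((j.1 a : ℤ) : ℂ) • kmon (m + j.1) j.2 + if a = j.2 then ksum (m + j.1) m else 0

theorem derCentralAux_rel (m : Deg ν) (a : Fin (ν + 1)) :
    centralRel ν ≤ LinearMap.ker (derCentralAux m a) := by
  refine Submodule.span_le.mpr ?_
  rintro _ ⟨r, rfl⟩
  rw [SetLike.mem_coe, LinearMap.mem_ker, map_sum]
  simp only [derCentralAux, Finsupp.linearCombination_single, smul_add, smul_ite, smul_zero,
    Finset.sum_add_distrib, Finset.sum_ite_eq, Finset.mem_univ, if_true]
  have h1 : (∑ p : Fin (ν + 1), ((r p : ℤ) : ℂ) • ((r a : ℤ) : ℂ) • kmon (m + r) p)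
      = ((r a : ℤ) : ℂ) • ksum (m + r) r := by
    rw [ksum, Finset.smul_sum]
    exact Finset.sum_congr rfl fun p _ => smul_comm _ _ _
  rw [h1, ← smul_add, ← ksum_add, add_comm r m, ksum_self, smul_zero]

/-- Action of `𝒟` on `𝒦`. -/
noncomputable def derCentral : DerA ν →ₗ[ℂ] Central ν →ₗ[ℂ] Central ν :=
  Finsupp.linearCombination ℂ fun i : Deg ν × Fin (ν + 1) =>
    (centralRel ν).liftQ (derCentralAux i.1 i.2) (derCentralAux_rel i.1 i.2)

/-- Commutator in `𝒟`: `[t^m d_a, t^n d_b] = n_a t^{m+n} d_b - m_b t^{m+n} d_a`. -/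
noncomputable def derBr : DerA ν →ₗ[ℂ] DerA ν →ₗ[ℂ] DerA ν :=
  Finsupp.linearCombination ℂ fun i : Deg ν × Fin (ν + 1) =>
    Finsupp.linearCombination ℂ fun j : Deg ν × Fin (ν + 1) =>
      ((j.1 i.2 : ℤ) : ℂ) • dmon (i.1 + j.1) j.2 - ((i.1 j.2 : ℤ) : ℂ) • dmon (i.1 + j.1) i.2

/-- The 2-cocycle `φ₁(t^m d_a, t^n d_b) = - n_a m_b ∑ₚ mₚ t^{m+n} kₚ`. -/
noncomputable def phi₁ : DerA ν →ₗ[ℂ] DerA ν →ₗ[ℂ] Central ν :=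
  Finsupp.linearCombination ℂ fun i : Deg ν × Fin (ν + 1) =>
    Finsupp.linearCombination ℂ fun j : Deg ν × Fin (ν + 1) =>
      (-(((j.1 i.2 : ℤ) : ℂ) * ((i.1 j.2 : ℤ) : ℂ))) • ksum (i.1 + j.1) i.1

/-- The 2-cocycle `φ₂(t^m d_a, t^n d_b) = m_a n_b ∑ₚ mₚ t^{m+n} kₚ`. -/
noncomputable def phi₂ : DerA ν →ₗ[ℂ] DerA ν →ₗ[ℂ] Central ν :=
  Finsupp.linearCombination ℂ fun i : Deg ν × Fin (ν + 1) =>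
    Finsupp.linearCombination ℂ fun j : Deg ν × Fin (ν + 1) =>
      (((i.1 i.2 : ℤ) : ℂ) * ((j.1 j.2 : ℤ) : ℂ)) • ksum (i.1 + j.1) i.1

/-- An arbitrary linear combination `φ = c₁ φ₁ + c₂ φ₂`. -/
noncomputable def phi (c₁ c₂ : ℂ) : DerA ν →ₗ[ℂ] DerA ν →ₗ[ℂ] Central ν := c₁ • phi₁ + c₂ • phi₂

/-! ### Values on monomials -/

@[simp] theorem loopBr_single (m n : Deg ν) (x y : 𝔤) :
    loopBr (Finsupp.single m x) (Finsupp.single n y) = Finsupp.single (m + n) ⁅x, y⁆ := by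
  simp [loopBr]

@[simp] theorem kappa_single (Φ : InvariantForm 𝔤) (m n : Deg ν) (x y : 𝔤) :
    kappa Φ (Finsupp.single m x) (Finsupp.single n y) = Φ.form x y • ksum (m + n) m := by
  simp [kappa]

@[simp] theorem derLoop_dmon (m n : Deg ν) (a : Fin (ν + 1)) (x : 𝔤) :
    derLoop (dmon m a) (Finsupp.single n x) = ((n a : ℤ) : ℂ) • Finsupp.single (m + n) x := by
  simp [derLoop, dmon]

@[simp] theorem derCentral_kmon (m n : Deg ν) (a b : Fin (ν + 1)) :
    derCentral (dmon m a) (kmon n b) =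
      ((n a : ℤ) : ℂ) • kmon (m + n) b + if a = b then ksum (m + n) m else 0 := by
  simp only [derCentral, dmon, kmon, Finsupp.linearCombination_single, one_smul]
  erw [Submodule.liftQ_apply]
  simp [derCentralAux, kmon]

@[simp] theorem derBr_dmon (m n : Deg ν) (a b : Fin (ν + 1)) :
    derBr (dmon m a) (dmon n b) =
      ((n a : ℤ) : ℂ) • dmon (m + n) b - ((m b : ℤ) : ℂ) • dmon (m + n) a := by
  simp [derBr, dmon]

@[simp] theorem phi_dmon (c₁ c₂ : ℂ) (m n : Deg ν) (a b : Fin (ν + 1)) :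
    phi c₁ c₂ (dmon m a) (dmon n b) =
      (-(c₁ * (((n a : ℤ) : ℂ) * ((m b : ℤ) : ℂ))) + c₂ * (((m a : ℤ) : ℂ) * ((n b : ℤ) : ℂ))) •
        ksum (m + n) m := by
  simp only [phi, phi₁, phi₂, dmon, LinearMap.add_apply, LinearMap.smul_apply,
    Finsupp.linearCombination_single, one_smul, smul_smul, ← add_smul]
  congr 1
  ring

@[simp] theorem derCentral_ksum (m s u : Deg ν) (a : Fin (ν + 1)) :
    derCentral (dmon m a) (ksum s u) =
      ((s a : ℤ) : ℂ) • ksum (m + s) u + ((u a : ℤ) : ℂ) • ksum (m + s) m := by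
  rw [ksum, map_sum]
  simp only [map_smul, derCentral_kmon, smul_add, smul_ite, smul_zero, Finset.sum_add_distrib,
    Finset.sum_ite_eq, Finset.mem_univ, if_true]
  congr 1
  rw [ksum, Finset.smul_sum]
  exact Finset.sum_congr rfl fun p _ => smul_comm _ _ _

theorem eq_zero_of_eq_neg {M : Type*} [AddCommGroup M] [Module ℂ M] {v : M} (h : v = -v) :
    v = 0 := by
  have h2 : (2 : ℂ) • v = 0 := by
    rw [two_smul]
    nth_rewrite 2 [h]
    exact add_neg_cancel v
  exact (smul_eq_zero.mp h2).resolve_left two_ne_zero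

/-! ### Induction principles and the Lie algebra identities -/

theorem loop_ind {P : Loop 𝔤 ν → Prop} (h0 : P 0) (ha : ∀ x y, P x → P y → P (x + y))
    (hs : ∀ m x, P (Finsupp.single m x)) (x : Loop 𝔤 ν) : P x :=
  Finsupp.induction_linear x h0 (fun x y => ha x y) hs

theorem der_ind {P : DerA ν → Prop} (h0 : P 0) (ha : ∀ x y, P x → P y → P (x + y))
    (hc : ∀ (c : ℂ) x, P x → P (c • x)) (hs : ∀ m a, P (dmon m a)) (x : DerA ν) : P x :=
  Finsupp.induction_linear x h0 (fun x y => ha x y) fun i c => by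
    have := hc c _ (hs i.1 i.2)
    rwa [dmon, Finsupp.smul_single, smul_eq_mul, mul_one] at this

theorem central_ind {P : Central ν → Prop} (h0 : P 0) (ha : ∀ x y, P x → P y → P (x + y))
    (hc : ∀ (c : ℂ) x, P x → P (c • x)) (hs : ∀ m p, P (kmon m p)) (x : Central ν) : P x := by
  obtain ⟨x, rfl⟩ := Submodule.Quotient.mk_surjective _ x
  refine Finsupp.induction_linear x h0 (fun x y hx hy => ?_) fun i c => ?_
  · exact ha _ _ hx hy
  · have := hc c _ (hs i.1 i.2)
    rwa [kmon, ← Submodule.Quotient.mk_smul, Finsupp.smul_single, smul_eq_mul, mul_one] at this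

theorem ksum_skew (m n : Deg ν) : ksum (m + n) n = -ksum (m + n) m := by
  rw [eq_neg_iff_add_eq_zero, add_comm, ← ksum_add, ksum_self]

theorem ksum_skew' (m n : Deg ν) : ksum (n + m) n = -ksum (m + n) m := by
  rw [add_comm n m, ksum_skew]

theorem loopBr_skew (x y : Loop 𝔤 ν) : loopBr x y = -loopBr y x := by
  induction x using loop_ind with
  | h0 => simp
  | ha x x' h h' => simp [h, h', add_comm]
  | hs m x =>
    induction y using loop_ind with
    | h0 => simp
    | ha y y' h h' => simp [h, h', add_comm]
    | hs n y => rw [loopBr_single, loopBr_single, ← lie_skew, Finsupp.single_neg, add_comm]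

theorem kappa_skew (Φ : InvariantForm 𝔤) (x y : Loop 𝔤 ν) : kappa Φ x y = -kappa Φ y x := by
  induction x using loop_ind with
  | h0 => simp
  | ha x x' h h' => simp [h, h', add_comm]
  | hs m x =>
    induction y using loop_ind with
    | h0 => simp
    | ha y y' h h' => simp [h, h', add_comm]
    | hs n y => rw [kappa_single, kappa_single, Φ.symm y x, ksum_skew' m n, smul_neg, neg_neg]

theorem derBr_skew (x y : DerA ν) : derBr x y = -derBr y x := by
  induction x using der_ind with
  | h0 => simp
  | ha x x' h h' => simp [h, h', add_comm]
  | hc c x h => simp [h]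
  | hs m a =>
    induction y using der_ind with
    | h0 => simp
    | ha y y' h h' => simp [h, h', add_comm]
    | hc c y h => simp [h]
    | hs n b => simp [add_comm n m]

theorem phi_skew (c₁ c₂ : ℂ) (x y : DerA ν) : phi c₁ c₂ x y = -phi c₁ c₂ y x := by
  induction x using der_ind with
  | h0 => simp
  | ha x x' h h' => simp [h, h', add_comm]
  | hc c x h => simp [h]
  | hs m a =>
    induction y using der_ind with
    | h0 => simp
    | ha y y' h h' => simp [h, h', add_comm]
    | hc c y h => simp [h]
    | hs n b =>
      rw [phi_dmon, phi_dmon, ksum_skew' m n, smul_neg, neg_neg]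
      congr 1
      ring

theorem loopBr_jacobi (x y z : Loop 𝔤 ν) :
    loopBr x (loopBr y z) = loopBr (loopBr x y) z + loopBr y (loopBr x z) := by
  induction x using loop_ind with
  | h0 => simp
  | ha x x' h h' => simp only [map_add, LinearMap.add_apply, h, h']; abel
  | hs m x =>
    induction y using loop_ind with
    | h0 => simp
    | ha y y' h h' => simp only [map_add, LinearMap.add_apply, h, h']; abel
    | hs n y =>
      induction z using loop_ind with
      | h0 => simp
      | ha z z' h h' => simp only [map_add, h, h']; abel
      | hs r z =>
        simp only [loopBr_single]
        rw [leibniz_lie, Finsupp.single_add, add_assoc, add_left_comm n m r]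

theorem kappa_jacobi (Φ : InvariantForm 𝔤) (x y z : Loop 𝔤 ν) :
    kappa Φ x (loopBr y z) = kappa Φ (loopBr x y) z + kappa Φ y (loopBr x z) := by
  induction x using loop_ind with
  | h0 => simp
  | ha x x' h h' => simp only [map_add, LinearMap.add_apply, h, h']; abel
  | hs m x =>
    induction y using loop_ind with
    | h0 => simp
    | ha y y' h h' => simp only [map_add, LinearMap.add_apply, h, h']; abel
    | hs n y =>
      induction z using loop_ind with
      | h0 => simp
      | ha z z' h h' => simp only [map_add, h, h']; abel
      | hs r z =>
        simp only [loopBr_single, kappa_single]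
        have h1 : Φ.form y ⁅x, z⁆ = -Φ.form x ⁅y, z⁆ := by
          rw [← Φ.invariant, ← lie_skew, map_neg, LinearMap.neg_apply, Φ.invariant]
        rw [Φ.invariant, h1, ← add_assoc, ← add_assoc, add_comm n m, ksum_add]
        module

theorem derLoop_loopBr (d : DerA ν) (x y : Loop 𝔤 ν) :
    derLoop d (loopBr x y) = loopBr (derLoop d x) y + loopBr x (derLoop d y) := by
  induction d using der_ind with
  | h0 => simp
  | ha x x' h h' => simp only [map_add, LinearMap.add_apply, h, h']; abel
  | hc c x h => simp [h]
  | hs m a =>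
    induction x using loop_ind with
    | h0 => simp
    | ha x x' h h' => simp only [map_add, LinearMap.add_apply, h, h']; abel
    | hs n x =>
      induction y using loop_ind with
      | h0 => simp
      | ha y y' h h' => simp only [map_add, h, h']; abel
      | hs r y =>
        simp only [loopBr_single, derLoop_dmon, map_smul, LinearMap.smul_apply]
        rw [add_left_comm n m r, ← add_assoc, ← add_smul, Pi.add_apply, Int.cast_add]

theorem derCentral_kappa (Φ : InvariantForm 𝔤) (d : DerA ν) (x y : Loop 𝔤 ν) :
    derCentral d (kappa Φ x y) = kappa Φ (derLoop d x) y + kappa Φ x (derLoop d y) := by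
  induction d using der_ind with
  | h0 => simp
  | ha x x' h h' => simp only [map_add, LinearMap.add_apply, h, h']; abel
  | hc c x h => simp [h]
  | hs m a =>
    induction x using loop_ind with
    | h0 => simp
    | ha x x' h h' => simp only [map_add, LinearMap.add_apply, h, h']; abel
    | hs n x =>
      induction y using loop_ind with
      | h0 => simp
      | ha y y' h h' => simp only [map_add, h, h']; abel
      | hs r y =>
        simp only [kappa_single, derLoop_dmon, map_smul, LinearMap.smul_apply, derCentral_ksum]
        rw [add_left_comm n m r, ← add_assoc m n r, ksum_add _ m n, Pi.add_apply, Int.cast_add]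
        module

theorem derLoop_derBr (d e : DerA ν) (x : Loop 𝔤 ν) :
    derLoop (derBr d e) x = derLoop d (derLoop e x) - derLoop e (derLoop d x) := by
  induction d using der_ind with
  | h0 => simp
  | ha x x' h h' => simp only [map_add, LinearMap.add_apply, h, h']; abel
  | hc c x h => simp [h, smul_sub]
  | hs m a =>
    induction e using der_ind with
    | h0 => simp
    | ha x x' h h' => simp only [map_add, LinearMap.add_apply, h, h']; abel
    | hc c x h => simp [h, smul_sub]
    | hs n b =>
      induction x using loop_ind with
      | h0 => simp
      | ha y y' h h' => simp only [map_add, h, h']; abel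
      | hs r x =>
        simp only [derBr_dmon, map_sub, map_smul, LinearMap.sub_apply, LinearMap.smul_apply,
          derLoop_dmon]
        rw [add_left_comm n m r, ← add_assoc m n r]
        simp only [Pi.add_apply, Int.cast_add]
        module

theorem derBr_jacobi (d e f : DerA ν) :
    derBr d (derBr e f) = derBr (derBr d e) f + derBr e (derBr d f) := by
  induction d using der_ind with
  | h0 => simp
  | ha x x' h h' => simp only [map_add, LinearMap.add_apply, h, h']; abel
  | hc c x h => simp [h, smul_add]
  | hs m a =>
    induction e using der_ind with
    | h0 => simp
    | ha x x' h h' => simp only [map_add, LinearMap.add_apply, h, h']; abel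
    | hc c x h => simp [h, smul_add]
    | hs n b =>
      induction f using der_ind with
      | h0 => simp
      | ha x x' h h' => simp only [map_add, h, h']; abel
      | hc c x h => simp [h, smul_add]
      | hs r c =>
        simp only [derBr_dmon, map_sub, map_smul, LinearMap.sub_apply, LinearMap.smul_apply]
        rw [add_left_comm n m r, ← add_assoc m n r]
        simp only [Pi.add_apply, Int.cast_add]
        module

theorem derCentral_derBr (d e : DerA ν) (k : Central ν) :
    derCentral (derBr d e) k =
      derCentral d (derCentral e k) - derCentral e (derCentral d k) := by
  induction d using der_ind with
  | h0 => simp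
  | ha x x' h h' => simp only [map_add, LinearMap.add_apply, h, h']; abel
  | hc c x h => simp [h, smul_sub]
  | hs m a =>
    induction e using der_ind with
    | h0 => simp
    | ha x x' h h' => simp only [map_add, LinearMap.add_apply, h, h']; abel
    | hc c x h => simp [h, smul_sub]
    | hs n b =>
      induction k using central_ind with
      | h0 => simp
      | ha y y' h h' => simp only [map_add, h, h']; abel
      | hc c x h => simp only [map_smul, h, smul_sub]
      | hs r c =>
        simp only [derBr_dmon, map_sub, map_smul, LinearMap.sub_apply, LinearMap.smul_apply,
          derCentral_kmon, map_add, apply_ite (derCentral (dmon m a)),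
          apply_ite (derCentral (dmon n b)), derCentral_ksum, map_zero]
        rw [add_left_comm n m r, ← add_assoc m n r]
        simp only [Pi.add_apply, Int.cast_add, ksum_add]
        split_ifs <;> module

theorem phi_cocycle (c₁ c₂ : ℂ) (d e f : DerA ν) :
    phi c₁ c₂ d (derBr e f) + derCentral d (phi c₁ c₂ e f) =
      (phi c₁ c₂ (derBr d e) f - derCentral f (phi c₁ c₂ d e)) +
        (phi c₁ c₂ e (derBr d f) + derCentral e (phi c₁ c₂ d f)) := by
  induction d using der_ind with
  | h0 => simp
  | ha x x' h h' =>
    simp only [map_add, LinearMap.add_apply]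
    linear_combination (norm := module) h + h'
  | hc c x h =>
    simp only [map_smul, LinearMap.smul_apply]
    linear_combination (norm := module) c • h
  | hs m a =>
    induction e using der_ind with
    | h0 => simp
    | ha x x' h h' =>
      simp only [map_add, LinearMap.add_apply]
      linear_combination (norm := module) h + h'
    | hc c x h =>
      simp only [map_smul, LinearMap.smul_apply]
      linear_combination (norm := module) c • h
    | hs n b =>
      induction f using der_ind with
      | h0 => simp
      | ha x x' h h' =>
        simp only [map_add, LinearMap.add_apply]
        linear_combination (norm := module) h + h'
      | hc c x h =>
        simp only [map_smul, LinearMap.smul_apply]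
        linear_combination (norm := module) c • h
      | hs r c =>
        simp only [derBr_dmon, map_sub, map_smul, LinearMap.sub_apply, LinearMap.smul_apply,
          phi_dmon, derCentral_ksum]
        have hr : ksum (m + n + r) r = -ksum (m + n + r) m - ksum (m + n + r) n := by
          have := ksum_self (m + n + r)
          rw [ksum_add, ksum_add] at this
          linear_combination (norm := module) this
        rw [add_left_comm n m r, add_comm r (m + n), ← add_assoc m n r, hr]
        simp only [Pi.add_apply, Int.cast_add, ksum_add]
        module

end Pieces

/-- The full toroidal Lie algebra `τ = 𝔤 ⊗ A ⊕ 𝒦 ⊕ 𝒟` attached to `𝔤`, its form `(· | ·)` and the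
cocycle `φ = c₁ φ₁ + c₂ φ₂`. -/
@[ext]
structure Tau {𝔤 : Type*} [LieRing 𝔤] [LieAlgebra ℂ 𝔤] (ν : ℕ) (Φ : InvariantForm 𝔤)
    (c₁ c₂ : ℂ) where
  loop : Loop 𝔤 ν
  cen : Central ν
  der : DerA ν

namespace Tau

variable {𝔤 : Type*} [LieRing 𝔤] [LieAlgebra ℂ 𝔤] {ν : ℕ} {Φ : InvariantForm 𝔤} {c₁ c₂ : ℂ}

/-- `τ` is the direct sum of its three parts as a vector space. -/
def equivProd : Tau ν Φ c₁ c₂ ≃ Loop 𝔤 ν × Central ν × DerA ν where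
  toFun X := (X.loop, X.cen, X.der)
  invFun p := ⟨p.1, p.2.1, p.2.2⟩
  left_inv _ := rfl
  right_inv _ := rfl

noncomputable instance : AddCommGroup (Tau ν Φ c₁ c₂) := equivProd.addCommGroup

noncomputable instance : Module ℂ (Tau ν Φ c₁ c₂) := equivProd.module ℂ

@[simp] theorem zero_loop : (0 : Tau ν Φ c₁ c₂).loop = 0 := rfl
@[simp] theorem zero_cen : (0 : Tau ν Φ c₁ c₂).cen = 0 := rfl
@[simp] theorem zero_der : (0 : Tau ν Φ c₁ c₂).der = 0 := rfl
@[simp] theorem add_loop (X Y : Tau ν Φ c₁ c₂) : (X + Y).loop = X.loop + Y.loop := rfl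
@[simp] theorem add_cen (X Y : Tau ν Φ c₁ c₂) : (X + Y).cen = X.cen + Y.cen := rfl
@[simp] theorem add_der (X Y : Tau ν Φ c₁ c₂) : (X + Y).der = X.der + Y.der := rfl
@[simp] theorem smul_loop (c : ℂ) (X : Tau ν Φ c₁ c₂) : (c • X).loop = c • X.loop := rfl
@[simp] theorem smul_cen (c : ℂ) (X : Tau ν Φ c₁ c₂) : (c • X).cen = c • X.cen := rfl
@[simp] theorem smul_der (c : ℂ) (X : Tau ν Φ c₁ c₂) : (c • X).der = c • X.der := rfl

/-- The bracket of `τ`, with `𝒦` central in `𝔤 ⊗ A ⊕ 𝒦`. -/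
noncomputable instance : Bracket (Tau ν Φ c₁ c₂) (Tau ν Φ c₁ c₂) where
  bracket X Y :=
    { loop := loopBr X.loop Y.loop + derLoop X.der Y.loop - derLoop Y.der X.loop
      cen := kappa Φ X.loop Y.loop + derCentral X.der Y.cen - derCentral Y.der X.cen
        + phi c₁ c₂ X.der Y.der
      der := derBr X.der Y.der }

@[simp] theorem lie_loop (X Y : Tau ν Φ c₁ c₂) : ⁅X, Y⁆.loop =
    loopBr X.loop Y.loop + derLoop X.der Y.loop - derLoop Y.der X.loop := rfl
@[simp] theorem lie_cen (X Y : Tau ν Φ c₁ c₂) : ⁅X, Y⁆.cen =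
    kappa Φ X.loop Y.loop + derCentral X.der Y.cen - derCentral Y.der X.cen
      + phi c₁ c₂ X.der Y.der := rfl
@[simp] theorem lie_der (X Y : Tau ν Φ c₁ c₂) : ⁅X, Y⁆.der = derBr X.der Y.der := rfl

noncomputable instance : LieRing (Tau ν Φ c₁ c₂) where
  add_lie X Y Z := by
    ext1
    · simp; abel
    · simp; abel
    · simp
  lie_add X Y Z := by
    ext1
    · simp; abel
    · simp; abel
    · simp
  lie_self X := by
    have h1 := eq_zero_of_eq_neg (loopBr_skew X.loop X.loop)
    have h2 := eq_zero_of_eq_neg (kappa_skew Φ X.loop X.loop)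
    have h3 := eq_zero_of_eq_neg (derBr_skew X.der X.der)
    have h4 := eq_zero_of_eq_neg (phi_skew c₁ c₂ X.der X.der)
    ext1
    · simp [h1]
    · simp [h2, h4]
    · simp [h3]
  leibniz_lie X Y Z := by
    ext1
    · simp only [lie_loop, lie_der, add_loop, map_add, map_sub, LinearMap.add_apply,
        LinearMap.sub_apply, derLoop_derBr, derLoop_loopBr]
      rw [loopBr_jacobi, loopBr_skew (derLoop Z.der X.loop) Y.loop,
        loopBr_skew (derLoop Y.der X.loop) Z.loop, loopBr_skew Z.loop (derLoop Y.der X.loop)]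
      abel
    · simp only [lie_loop, lie_der, lie_cen, add_cen, map_add, map_sub, LinearMap.add_apply,
        LinearMap.sub_apply, derCentral_derBr, derCentral_kappa]
      have h := phi_cocycle c₁ c₂ X.der Y.der Z.der
      have h' := kappa_jacobi Φ X.loop Y.loop Z.loop
      have h'' := kappa_skew Φ (derLoop Z.der X.loop) Y.loop
      linear_combination (norm := module) h + h' + h''
    · simp only [lie_der, add_der]
      exact derBr_jacobi _ _ _

noncomputable instance : LieAlgebra ℂ (Tau ν Φ c₁ c₂) where
  lie_smul c X Y := by
    ext1
    · simp [smul_add, smul_sub]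
    · simp [smul_add, smul_sub]
    · simp

end Tau

section Modules

open scoped Classical

variable {𝔤 : Type*} [LieRing 𝔤] [LieAlgebra ℂ 𝔤] [FiniteDimensional ℂ 𝔤]
  [LieAlgebra.IsSimple ℂ 𝔤]
  (H : LieSubalgebra ℂ 𝔤) [H.IsCartanSubalgebra]
  (ν : ℕ) (Φ : InvariantForm 𝔤) (c₁ c₂ : ℂ)
  (B : Type*) [CommRing B] [Algebra ℂ B]

/-- The map full toroidal Lie algebra `τ(B) = τ ⊗ B`, with `[b₁ ⊗ X₁, b₂ ⊗ X₂] = b₁b₂ ⊗ [X₁, X₂]`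
(the factor `B` is written on the left). -/
abbrev TauB : Type _ := B ⊗[ℂ] Tau ν Φ c₁ c₂

variable {B}

/-- The element `x ⊗ t^m ⊗ b` of `τ(B)`. -/
noncomputable def xt (x : 𝔤) (m : Deg ν) (b : B) : TauB ν Φ c₁ c₂ B :=
  b ⊗ₜ[ℂ] (⟨Finsupp.single m x, 0, 0⟩ : Tau ν Φ c₁ c₂)

/-- The element `t^m kₚ ⊗ b` of `τ(B)`. -/
noncomputable def kt (m : Deg ν) (p : Fin (ν + 1)) (b : B) : TauB ν Φ c₁ c₂ B :=
  b ⊗ₜ[ℂ] (⟨0, kmon m p, 0⟩ : Tau ν Φ c₁ c₂)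

/-- The element `t^m d_a ⊗ b` of `τ(B)`. -/
noncomputable def dt (m : Deg ν) (a : Fin (ν + 1)) (b : B) : TauB ν Φ c₁ c₂ B :=
  b ⊗ₜ[ℂ] (⟨0, 0, dmon m a⟩ : Tau ν Φ c₁ c₂)

variable (B)

/-- The Cartan subalgebra `𝔥 = 𝔥̇ ⊕ ⨁ᵢ ℂ kᵢ ⊕ ⨁ᵢ ℂ dᵢ`, in coordinates. -/
abbrev Cartan : Type _ := H × (Fin (ν + 1) → ℂ) × (Fin (ν + 1) → ℂ)

/-- The embedding of `𝔥` into `τ(B)` as `𝔥 ⊗ 1`. -/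
noncomputable def cartanElt (h : Cartan H ν) : TauB ν Φ c₁ c₂ B :=
  xt ν Φ c₁ c₂ (h.1 : 𝔤) 0 1 + ∑ i, h.2.1 i • kt ν Φ c₁ c₂ 0 i 1
    + ∑ i, h.2.2 i • dt ν Φ c₁ c₂ 0 i 1

variable (V : Type*) [AddCommGroup V] [Module ℂ V] [LieRingModule (TauB ν Φ c₁ c₂ B) V]
  [LieModule ℂ (TauB ν Φ c₁ c₂ B) V]

/-- The weight space `V_λ = {v | h v = λ(h) v for all h ∈ 𝔥}`, for `λ ∈ 𝔥*`. -/
def weightSpace (lam : Module.Dual ℂ (Cartan H ν)) : Submodule ℂ V where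
  carrier := {v | ∀ h : Cartan H ν, ⁅cartanElt H ν Φ c₁ c₂ B h, v⁆ = lam h • v}
  zero_mem' := by simp
  add_mem' {v w} hv hw h := by rw [lie_add, hv h, hw h, smul_add]
  smul_mem' c v hv h := by rw [lie_smul, hv h, smul_comm]

/-- Integrable modules: `V` is the direct sum of its weight spaces, and the elements
`x ⊗ t^m ⊗ b` with `x` in a root space `𝔤_α` act locally nilpotently. -/
structure IsIntegrable : Prop where
  weight : DirectSum.IsInternal (weightSpace H ν Φ c₁ c₂ B V)
  nilpotent : ∀ (α : LieModule.Weight ℂ H 𝔤), α.IsNonZero → ∀ x ∈ LieAlgebra.rootSpace H α,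
    ∀ (m : Deg ν) (b : B) (v : V),
      ∃ n : ℕ, ((LieModule.toEnd ℂ (TauB ν Φ c₁ c₂ B) V (xt ν Φ c₁ c₂ x m b)) ^ n) v = 0

/-- `V` belongs to `𝒞_fin`: it is integrable with finite-dimensional weight spaces. -/
structure IsCfin : Prop extends IsIntegrable H ν Φ c₁ c₂ B V where
  finite : ∀ lam : Module.Dual ℂ (Cartan H ν),
    FiniteDimensional ℂ (weightSpace H ν Φ c₁ c₂ B V lam)

variable {H} (base : (LieAlgebra.IsKilling.rootSystem H).Base)

/-- `T = {v ∈ V | (𝔤₊ ⊗ A ⊗ B) v = 0}`, where `𝔤₊` is the sum of the root spaces `𝔤_α` over the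
roots `α` that are positive with respect to the chosen base. -/
def topSpace : Submodule ℂ V where
  carrier := {v | ∀ α, base.IsPos α → ∀ x ∈ LieAlgebra.rootSpace H α.1,
    ∀ (m : Deg ν) (b : B), ⁅xt ν Φ c₁ c₂ x m b, v⁆ = 0}
  zero_mem' := by simp
  add_mem' {v w} hv hw α hα x hx m b := by
    rw [lie_add, hv α hα x hx m b, hw α hα x hx m b, add_zero]
  smul_mem' c v hv α hα x hx m b := by rw [lie_smul, hv α hα x hx m b, smul_zero]

end Modules

end FullToroidal

/-! In fact `𝔤 ⊗ A ⊗ ker ψ` annihilates all of `V`; the claim follows by writing `b = ψ(b)·1 + (b -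
ψ(b)·1)`. If `T = 0` only the existence of some `ψ` matters, and the Nullstellensatz provides one.
Otherwise let `E` be the part of `T` on which `ρ^∨` has a fixed eigenvalue `c` attained on a weight
vector. Lowering operators decrease this eigenvalue by positive integers, so a nonzero subspace of
`E` stable under the zero part `(𝔥̇ ⊗ A ⊕ 𝒦 ⊕ 𝒟) ⊗ B` generates `V` downwards and must be the whole
`c`-eigenspace. Hence `E` is irreducible under the zero part, and lowering a vector of `E` never
gives a nonzero vector of `T` (`exists_isTop`).

By a Schur argument on finite-dimensional weight spaces, each `h ⊗ 1 ⊗ b` acts on `E` by a scalar;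
for `b = 1` it is `λ(h)`. If `λ = 0`, sl₂ theory makes `𝔤 ⊗ A ⊗ B` act by zero, which is excluded.
If `λ(α^∨) = N > 0`, the operators `(f ⊗ t^{-q})^N` are injective on `E` and translate degrees by
`-Nq`, so the graded pieces of `E` have bounded dimension (`IsTop.exists_finrank_le`).

Bounded dimension is what drives the rest. The operators `t^{-q} d_a` and `h ⊗ t^q` form a
Heisenberg pair on `E` with scalar `λ(h)` when `q_a = 1`. With bounded pieces, an operator of degree
`q` commuting with such a pair is nilpotent (`pow_eq_zero_of_heisenberg`), and two independent pairs
cannot coexist (`det_eq_zero_of_heisenberg`). The vanishing determinant says precisely that the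
scalars of `h ⊗ b` are `ψ(b) λ(h)` with `ψ` multiplicative (`IsTop.exists_character`). Nilpotency
applies first to `t^q k_p`, then to `h ⊗ t^q ⊗ j` with `ψ(j) = 0`; commuting with `t^n d_a ⊗ b`
spreads the vanishing to all degrees and coefficients. This shows that `𝒦 ⊗ B` kills `V`
(`lie_kt_eq_zero`) and that `𝔥̇ ⊗ A ⊗ ker ψ` kills `E`. Induction on height extends the latter to
all of `𝔤`, and irreducibility extends it from `E` to `V` (`IsTop.lie_xt_ker_eq_zero`). -/

namespace FullToroidal

/-! ### Brackets of the generators of `τ(B)` and the irreducibility criterion on generators. -/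

section Brackets

set_option linter.unusedSectionVars false

variable {𝔤 : Type*} [LieRing 𝔤] [LieAlgebra ℂ 𝔤] {ν : ℕ} {Φ : InvariantForm 𝔤} {c₁ c₂ : ℂ}
  {B : Type*} [CommRing B] [Algebra ℂ B]

local notation "XT" => xt ν Φ c₁ c₂
local notation "KT" => kt (𝔤 := 𝔤) ν Φ c₁ c₂
local notation "DT" => dt (𝔤 := 𝔤) ν Φ c₁ c₂

/-- The embedding of `𝒦` into `τ` as a linear map. -/
noncomputable def Tau.ofCen : Central ν →ₗ[ℂ] Tau ν Φ c₁ c₂ where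
  toFun k := ⟨0, k, 0⟩
  map_add' x y := by ext1 <;> simp
  map_smul' c x := by ext1 <;> simp

/-- The embedding of `𝔤 ⊗ A` into `τ` as a linear map. -/
noncomputable def Tau.ofLoop : Loop 𝔤 ν →ₗ[ℂ] Tau ν Φ c₁ c₂ where
  toFun k := ⟨k, 0, 0⟩
  map_add' x y := by ext1 <;> simp
  map_smul' c x := by ext1 <;> simp

/-- The embedding of `𝒟` into `τ` as a linear map. -/
noncomputable def Tau.ofDer : DerA ν →ₗ[ℂ] Tau ν Φ c₁ c₂ where
  toFun k := ⟨0, 0, k⟩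
  map_add' x y := by ext1 <;> simp
  map_smul' c x := by ext1 <;> simp

theorem tmul_eq_zero_of_eq_zero (b : B) {X : Tau ν Φ c₁ c₂} (h : X = 0) :
    b ⊗ₜ[ℂ] X = (0 : TauB ν Φ c₁ c₂ B) := by
  rw [h, TensorProduct.tmul_zero]

/-- The element `∑ₚ uₚ t^m kₚ ⊗ b` of `τ(B)`. -/
noncomputable def kst (ν : ℕ) (Φ : InvariantForm 𝔤) (c₁ c₂ : ℂ) (m u : Deg ν) (b : B) :
    TauB ν Φ c₁ c₂ B :=
  ∑ p, ((u p : ℤ) : ℂ) • kt ν Φ c₁ c₂ m p b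

local notation "KST" => kst (𝔤 := 𝔤) ν Φ c₁ c₂

theorem tmul_ofCen_ksum (m u : Deg ν) (b : B) :
    b ⊗ₜ[ℂ] (Tau.ofCen (ksum m u) : Tau ν Φ c₁ c₂) = KST m u b := by
  rw [ksum, map_sum, TensorProduct.tmul_sum, kst]
  exact Finset.sum_congr rfl fun p _ => by rw [map_smul, TensorProduct.tmul_smul]; rfl

theorem lie_xt_xt (x y : 𝔤) (m n : Deg ν) (b b' : B) :
    ⁅XT x m b, XT y n b'⁆ = XT ⁅x, y⁆ (m + n) (b * b') + Φ.form x y • KST (m + n) m (b * b') := by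
  rw [← tmul_ofCen_ksum, ← TensorProduct.tmul_smul, ← map_smul]
  simp only [xt]
  rw [LieAlgebra.ExtendScalars.bracket_tmul, ← TensorProduct.tmul_add]
  congr 1
  ext1 <;> simp [Tau.ofCen]

theorem lie_dt_xt (a : Fin (ν + 1)) (x : 𝔤) (m n : Deg ν) (b b' : B) :
    ⁅DT m a b, XT x n b'⁆ = ((n a : ℤ) : ℂ) • XT x (m + n) (b * b') := by
  simp only [xt, dt]
  rw [LieAlgebra.ExtendScalars.bracket_tmul, ← TensorProduct.tmul_smul]
  congr 1
  ext1 <;> simp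

theorem lie_dt_kt (a p : Fin (ν + 1)) (m n : Deg ν) (b b' : B) :
    ⁅DT m a b, KT n p b'⁆ =
      ((n a : ℤ) : ℂ) • KT (m + n) p (b * b') + if a = p then KST (m + n) m (b * b') else 0 := by
  have : (if a = p then KST (m + n) m (b * b') else 0) =
      (b * b') ⊗ₜ[ℂ] (Tau.ofCen (if a = p then ksum (m + n) m else 0) : Tau ν Φ c₁ c₂) := by
    split_ifs
    · rw [tmul_ofCen_ksum]
    · simp
  rw [this]
  simp only [kt, dt]
  rw [LieAlgebra.ExtendScalars.bracket_tmul, ← TensorProduct.tmul_smul, ← TensorProduct.tmul_add]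
  congr 1
  ext1 <;> simp [Tau.ofCen]

theorem lie_xt_kt (x : 𝔤) (p : Fin (ν + 1)) (m n : Deg ν) (b b' : B) :
    ⁅XT x m b, KT n p b'⁆ = 0 := by
  simp only [xt, kt]
  rw [LieAlgebra.ExtendScalars.bracket_tmul]
  refine tmul_eq_zero_of_eq_zero _ ?_
  ext1 <;> simp

theorem lie_kt_kt (p q : Fin (ν + 1)) (m n : Deg ν) (b b' : B) :
    ⁅KT m p b, KT n q b'⁆ = 0 := by
  simp only [kt]
  rw [LieAlgebra.ExtendScalars.bracket_tmul]
  refine tmul_eq_zero_of_eq_zero _ ?_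
  ext1 <;> simp

/-- Supplies the two commuting operators of equal degree needed in the determinant argument. -/
theorem lie_dt_dt_self (a : Fin (ν + 1)) (m : Deg ν) (b b' : B) :
    ⁅DT m a b, DT m a b'⁆ = 0 := by
  simp only [dt]
  rw [LieAlgebra.ExtendScalars.bracket_tmul]
  refine tmul_eq_zero_of_eq_zero _ ?_
  ext1 <;> simp

/-- The degree derivations see no cocycle: its value carries the factor `∑ₚ mₚ t^n kₚ` with `m = 0`.
-/
theorem lie_dt_zero_dt (a a' : Fin (ν + 1)) (n : Deg ν) (b : B) :
    ⁅DT 0 a (1 : B), DT n a' b⁆ = ((n a : ℤ) : ℂ) • DT n a' b := by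
  simp only [dt]
  rw [LieAlgebra.ExtendScalars.bracket_tmul, ← TensorProduct.tmul_smul, one_mul]
  congr 1
  have : ksum n (0 : Deg ν) = 0 := by simp [ksum]
  ext1 <;> simp [this]

theorem xt_add_left (x y : 𝔤) (m : Deg ν) (b : B) : XT (x + y) m b = XT x m b + XT y m b := by
  simp only [xt, ← TensorProduct.tmul_add]
  congr 1
  ext1 <;> simp

theorem xt_smul_left (c : ℂ) (x : 𝔤) (m : Deg ν) (b : B) : XT (c • x) m b = c • XT x m b := by
  simp only [xt, ← TensorProduct.tmul_smul]
  congr 1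
  ext1 <;> simp

theorem xt_zero_left (m : Deg ν) (b : B) : XT 0 m b = 0 := by
  simpa using xt_smul_left (Φ := Φ) (c₁ := c₁) (c₂ := c₂) 0 0 m b

theorem xt_add_right (x : 𝔤) (m : Deg ν) (b b' : B) : XT x m (b + b') = XT x m b + XT x m b' :=
  TensorProduct.add_tmul _ _ _

theorem xt_sub_right (x : 𝔤) (m : Deg ν) (b b' : B) : XT x m (b - b') = XT x m b - XT x m b' :=
  TensorProduct.sub_tmul _ _ _

theorem xt_smul_right (c : ℂ) (x : 𝔤) (m : Deg ν) (b : B) : XT x m (c • b) = c • XT x m b :=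
  TensorProduct.smul_tmul' _ _ _

/-- `τ(B)` is spanned by the elements `x ⊗ t^m ⊗ b`, `t^m kₚ ⊗ b` and `t^m d_a ⊗ b`. -/
theorem tauB_induction {P : TauB ν Φ c₁ c₂ B → Prop} (h0 : P 0)
    (ha : ∀ X Y, P X → P Y → P (X + Y)) (hx : ∀ x m b, P (XT x m b))
    (hk : ∀ m p b, P (KT m p b)) (hd : ∀ m a b, P (DT m a b)) (X : TauB ν Φ c₁ c₂ B) : P X := by
  induction X using TensorProduct.induction_on with
  | zero => exact h0
  | add X Y hX hY => exact ha _ _ hX hY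
  | tmul b X =>
    have hX : X = Tau.ofLoop X.loop + Tau.ofCen X.cen + Tau.ofDer X.der := by
      ext1 <;> simp [Tau.ofLoop, Tau.ofCen, Tau.ofDer]
    rw [hX, TensorProduct.tmul_add, TensorProduct.tmul_add]
    refine ha _ _ (ha _ _ ?_ ?_) ?_
    · induction X.loop using loop_ind with
      | h0 => simpa using h0
      | ha x y h h' => rw [map_add, TensorProduct.tmul_add]; exact ha _ _ h h'
      | hs m x => exact hx x m b
    · suffices ∀ b : B, P (b ⊗ₜ[ℂ] Tau.ofCen X.cen) from this b
      induction X.cen using central_ind with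
      | h0 => simpa using h0
      | ha x y h h' => intro b; rw [map_add, TensorProduct.tmul_add]; exact ha _ _ (h b) (h' b)
      | hc c x h => intro b; rw [map_smul, ← TensorProduct.smul_tmul]; exact h _
      | hs m p => exact fun b => hk m p b
    · suffices ∀ b : B, P (b ⊗ₜ[ℂ] Tau.ofDer X.der) from this b
      induction X.der using der_ind with
      | h0 => simpa using h0
      | ha x y h h' => intro b; rw [map_add, TensorProduct.tmul_add]; exact ha _ _ (h b) (h' b)
      | hc c x h => intro b; rw [map_smul, ← TensorProduct.smul_tmul]; exact h _
      | hs m p => exact fun b => hd m p b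

variable {V : Type*} [AddCommGroup V] [Module ℂ V] [LieRingModule (TauB ν Φ c₁ c₂ B) V]
  [LieModule ℂ (TauB ν Φ c₁ c₂ B) V]

theorem tauB_lie_smul (c : ℂ) (X Y : TauB ν Φ c₁ c₂ B) : ⁅X, c • Y⁆ = c • ⁅X, Y⁆ :=
  lie_smul c X Y

theorem tauB_smul_lie (c : ℂ) (X : TauB ν Φ c₁ c₂ B) (v : V) : ⁅c • X, v⁆ = c • ⁅X, v⁆ :=
  smul_lie c X v

/-- Irreducibility in the form used throughout: since the three families span `τ(B)`, it is enough
to test stability on them. -/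
theorem eq_top_of_stable (hirr : LieModule.IsIrreducible ℂ (TauB ν Φ c₁ c₂ B) V)
    (S : Submodule ℂ V) (hS : S ≠ ⊥)
    (hx : ∀ x m (b : B), ∀ v ∈ S, ⁅XT x m b, v⁆ ∈ S)
    (hk : ∀ m p (b : B), ∀ v ∈ S, ⁅KT m p b, v⁆ ∈ S)
    (hd : ∀ m a (b : B), ∀ v ∈ S, ⁅DT m a b, v⁆ ∈ S) : S = ⊤ := by
  let S' : LieSubmodule ℂ (TauB ν Φ c₁ c₂ B) V :=
    { S with
      lie_mem := by
        intro X v hv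
        change v ∈ S at hv
        change ⁅X, v⁆ ∈ S
        induction X using tauB_induction with
        | h0 => simp
        | ha X Y hX hY => rw [add_lie]; exact add_mem hX hY
        | hx x m b => exact hx x m b v hv
        | hk m p b => exact hk m p b v hv
        | hd m a b => exact hd m a b v hv }
  have h1 : S' ≠ ⊥ := by
    intro h
    apply hS
    have := congrArg LieSubmodule.toSubmodule h
    simpa [S'] using this
  have h2 : S' = ⊤ := (eq_bot_or_eq_top S').resolve_left h1
  have := congrArg LieSubmodule.toSubmodule h2
  simpa [S'] using this

end Brackets

/-! ### Nilpotency and Heisenberg pairs on graded spaces with bounded pieces. -/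

section Operators

set_option linter.unusedSectionVars false

theorem commutator_pow {R : Type*} [Ring R] [Algebra ℂ R] {D a : R} {c : ℂ}
    (h : D * a - a * D = c • a) (j : ℕ) : D * a ^ j - a ^ j * D = (j * c) • a ^ j := by
  induction j with
  | zero => simp
  | succ j ih =>
    have : D * a ^ (j + 1) - a ^ (j + 1) * D =
        (D * a ^ j - a ^ j * D) * a + a ^ j * (D * a - a * D) := by noncomm_ring
    rw [this, ih, h, smul_mul_assoc, mul_smul_comm, ← pow_succ, ← add_smul]
    congr 1
    push_cast
    ring

/-- The powers of `a` are eigenvectors of `ad D` for the distinct eigenvalues `jc`, so only finitely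
many are nonzero; Cayley–Hamilton then bounds the exponent by the dimension. This explicit exponent
is what makes the bound uniform over graded pieces. -/
theorem pow_finrank_eq_zero_of_commutator {U : Type*} [AddCommGroup U] [Module ℂ U]
    [FiniteDimensional ℂ U] {D a : Module.End ℂ U} {c : ℂ} (hc : c ≠ 0)
    (h : D * a - a * D = c • a) : a ^ Module.finrank ℂ U = 0 := by
  have hnil : IsNilpotent a := by
    by_contra hn
    have hn' : ∀ j : ℕ, a ^ j ≠ 0 := fun j hj => hn ⟨j, hj⟩
    have hli := Module.End.eigenvectors_linearIndependent'
      (LinearMap.mulLeft ℂ D - LinearMap.mulRight ℂ D) (fun j : ℕ => (j : ℂ) * c)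
      (fun i j hij => by simpa [hc] using hij) (fun j : ℕ => a ^ j) fun j => by
        rw [Module.End.hasEigenvector_iff, Module.End.mem_eigenspace_iff]
        exact ⟨by simpa using commutator_pow h j, hn' j⟩
    exact not_finite_iff_infinite.mpr inferInstance hli.finite
  have h1 := LinearMap.aeval_self_charpoly a
  rwa [hnil.charpoly_eq_X_pow_finrank, map_pow, Polynomial.aeval_X] at h1

theorem pow_apply_eq_zero_of_commutator {V : Type*} [AddCommGroup V] [Module ℂ V]
    {U : Submodule ℂ V} [FiniteDimensional ℂ U] {n : ℕ} (hn : Module.finrank ℂ U ≤ n)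
    {D a : Module.End ℂ V} (hD : ∀ u ∈ U, D u ∈ U) (ha : ∀ u ∈ U, a u ∈ U) {c : ℂ} (hc : c ≠ 0)
    (h : ∀ u ∈ U, D (a u) - a (D u) = c • a u) {u : V} (hu : u ∈ U) : (a ^ n) u = 0 := by
  have key : (a.restrict ha) ^ Module.finrank ℂ U = 0 := by
    refine pow_finrank_eq_zero_of_commutator (D := D.restrict hD) hc ?_
    ext ⟨w, hw⟩
    simpa using h w hw
  have h2 : (a.restrict ha) ^ n = 0 := pow_eq_zero_of_le hn key
  rw [Module.End.pow_restrict] at h2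
  simpa using congrArg Subtype.val (LinearMap.congr_fun h2 ⟨u, hu⟩)

theorem commutator_pow_of_eq_one {R : Type*} [Ring R] {P Q : R} (h : P * Q - Q * P = 1) (n : ℕ) :
    P * Q ^ (n + 1) = Q ^ (n + 1) * P + (n + 1 : ℕ) • Q ^ n := by
  have h' : P * Q = Q * P + 1 := by rw [← h]; abel
  induction n with
  | zero => simpa using h'
  | succ n ih =>
    rw [pow_succ Q (n + 1), ← mul_assoc, ih, add_mul, mul_assoc, h', mul_add, mul_one,
      ← mul_assoc, smul_mul_assoc, ← pow_succ, ← pow_succ, add_assoc, succ_nsmul' _ (n + 1)]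

/-- `P` acts as differentiation with respect to `Q` and passes through `X`, so applying it to `Q ^
(n + 1) * X = 0` lowers the exponent. -/
theorem eq_zero_of_pow_mul_eq_zero {R : Type*} [Ring R] [Algebra ℂ R] {P Q X : R}
    (h : P * Q - Q * P = 1) (hX : P * X = X * P) {n : ℕ} (h0 : Q ^ n * X = 0) : X = 0 := by
  induction n with
  | zero => simpa using h0
  | succ n ih =>
    apply ih
    have h1 : P * (Q ^ (n + 1) * X) = (n + 1 : ℕ) • (Q ^ n * X) := by
      rw [← mul_assoc, commutator_pow_of_eq_one h, add_mul, mul_assoc, hX, ← mul_assoc, h0,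
        zero_mul, zero_add, smul_mul_assoc]
    rw [h0, mul_zero, ← Nat.cast_smul_eq_nsmul ℂ] at h1
    exact (smul_eq_zero.mp h1.symm).resolve_left (Nat.cast_ne_zero.mpr n.succ_ne_zero)

variable {Γ V : Type*} [AddGroup Γ] [AddCommGroup V] [Module ℂ V] {E : Γ → Submodule ℂ V}

theorem iSup_mapsTo {T : Module.End ℂ V} {q : Γ} (hT : ∀ i, ∀ v ∈ E i, T v ∈ E (q + i)) :
    ∀ v ∈ ⨆ i, E i, T v ∈ ⨆ i, E i := by
  intro v hv
  refine Submodule.iSup_induction E (motive := fun v => T v ∈ ⨆ i, E i) hv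
    (fun i v hv => Submodule.mem_iSup_of_mem _ (hT i v hv)) (by simp) fun x y hx hy => ?_
  rw [map_add]
  exact add_mem hx hy

variable [∀ i, FiniteDimensional ℂ (E i)] {n : ℕ}

theorem iSup_pow_eq_zero_of_commutator (hn : ∀ i, Module.finrank ℂ (E i) ≤ n)
    {D e : Module.End ℂ V} (hD : ∀ i, ∀ v ∈ E i, D v ∈ E i) (he : ∀ i, ∀ v ∈ E i, e v ∈ E i)
    {c : ℂ} (hc : c ≠ 0) (h : ∀ v ∈ ⨆ i, E i, D (e v) - e (D v) = c • e v) :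
    ∀ v ∈ ⨆ i, E i, (e ^ n) v = 0 := by
  intro v hv
  refine Submodule.iSup_induction E (motive := fun v => (e ^ n) v = 0) hv
    (fun i v hv => pow_apply_eq_zero_of_commutator (hn i) (hD i) (he i) hc
      (fun u hu => h u (Submodule.mem_iSup_of_mem i hu)) hv) (by simp) fun x y hx hy => ?_
  rw [map_add, hx, hy, add_zero]

/-- On a graded space with pieces of bounded dimension, an operator `X` of degree `q` that commutes
with a Heisenberg pair `P`, `Q` of degrees `-q`, `q` is nilpotent. -/
theorem pow_eq_zero_of_heisenberg (hn : ∀ i, Module.finrank ℂ (E i) ≤ n) {q : Γ}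
    {P Q X : Module.End ℂ V} (hP : ∀ i, ∀ v ∈ E i, P v ∈ E (-q + i))
    (hQ : ∀ i, ∀ v ∈ E i, Q v ∈ E (q + i)) (hX : ∀ i, ∀ v ∈ E i, X v ∈ E (q + i))
    {c : ℂ} (hc : c ≠ 0) (hPQ : ∀ v ∈ ⨆ i, E i, P (Q v) - Q (P v) = c • v)
    (hPX : ∀ v ∈ ⨆ i, E i, P (X v) = X (P v)) (hQX : ∀ v ∈ ⨆ i, E i, Q (X v) = X (Q v)) :
    ∀ v ∈ ⨆ i, E i, (X ^ n) v = 0 := by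
  have hPF := iSup_mapsTo hP
  have hQF := iSup_mapsTo hQ
  have hXF := iSup_mapsTo hX
  -- Both `QP` and `XP` have degree zero, and `[QP, XP] = X(QP - PQ)P = -c XP`; hence `(XP)^n = 0`
  -- with one `n` for all pieces.
  have he := iSup_pow_eq_zero_of_commutator hn (D := Q * P) (e := X * P)
    (fun i v hv => by simpa using hQ _ _ (hP i v hv))
    (fun i v hv => by simpa using hX _ _ (hP i v hv)) (neg_ne_zero.mpr hc) (fun v hv => by
      have h1 := hPQ (P v) (hPF v hv)
      simp only [Module.End.mul_apply]
      rw [hPX _ (hPF v hv), hQX _ (hPF _ (hPF v hv)), ← map_sub, ← neg_sub, h1, ← neg_smul,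
        map_smul])
  set P' := P.restrict hPF with hP'
  set Q' := Q.restrict hQF with hQ'
  set X' := X.restrict hXF with hX'
  have hcomm : Commute X' P' := by
    ext ⟨v, hv⟩
    exact (hPX v hv).symm
  have hXPn : X' ^ n * P' ^ n = 0 := by
    rw [← hcomm.mul_pow]
    have : X' * P' = (X * P).restrict (fun v hv => hXF _ (hPF v hv)) := rfl
    rw [this, Module.End.pow_restrict]
    ext ⟨v, hv⟩
    simpa using he v hv
  have h0 : X' ^ n = 0 := by
    -- The roles are exchanged: `-c⁻¹ Q` differentiates powers of `P`, which strips `P^n` from `P^n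
    -- X^n = 0`.
    refine eq_zero_of_pow_mul_eq_zero (P := -c⁻¹ • Q') (Q := P') (n := n) ?_ ?_ ?_
    · ext ⟨v, hv⟩
      have := hPQ v hv
      simp only [hP', hQ', LinearMap.sub_apply, Module.End.mul_apply, Module.End.one_apply,
        LinearMap.smul_apply, map_smul, ← smul_sub]
      simp only [LinearMap.coe_restrict_apply, Submodule.coe_smul, Submodule.coe_sub]
      rw [← neg_sub, this, neg_smul, smul_neg, neg_neg, smul_smul, inv_mul_cancel₀ hc, one_smul]
    · have hc' : Commute Q' X' := by
        ext ⟨v, hv⟩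
        exact hQX v hv
      exact ((hc'.smul_left (-c⁻¹)).pow_right n).eq
    · rw [← (hcomm.pow_pow n n).eq]
      exact hXPn
  intro v hv
  rw [hX', Module.End.pow_restrict] at h0
  simpa using congrArg Subtype.val (LinearMap.congr_fun h0 ⟨v, hv⟩)

/-- On a graded space with pieces of bounded dimension, there are no two independent Heisenberg
pairs of degrees `-q`, `q`. -/
theorem det_eq_zero_of_heisenberg (hn : ∀ i, Module.finrank ℂ (E i) ≤ n) (hE : ∃ i, E i ≠ ⊥) {q : Γ}
    {P₁ P₂ Q₁ Q₂ : Module.End ℂ V} (hP₁ : ∀ i, ∀ v ∈ E i, P₁ v ∈ E (-q + i))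
    (hP₂ : ∀ i, ∀ v ∈ E i, P₂ v ∈ E (-q + i))
    (hQ₁ : ∀ i, ∀ v ∈ E i, Q₁ v ∈ E (q + i)) (hQ₂ : ∀ i, ∀ v ∈ E i, Q₂ v ∈ E (q + i))
    {c₁₁ c₁₂ c₂₁ c₂₂ : ℂ}
    (h₁₁ : ∀ v ∈ ⨆ i, E i, P₁ (Q₁ v) - Q₁ (P₁ v) = c₁₁ • v)
    (h₁₂ : ∀ v ∈ ⨆ i, E i, P₁ (Q₂ v) - Q₂ (P₁ v) = c₁₂ • v)
    (h₂₁ : ∀ v ∈ ⨆ i, E i, P₂ (Q₁ v) - Q₁ (P₂ v) = c₂₁ • v)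
    (h₂₂ : ∀ v ∈ ⨆ i, E i, P₂ (Q₂ v) - Q₂ (P₂ v) = c₂₂ • v)
    (hP : ∀ v ∈ ⨆ i, E i, P₁ (P₂ v) = P₂ (P₁ v)) :
    c₁₁ * c₂₂ = c₁₂ * c₂₁ := by
  by_contra hdet
  set δ := c₁₁ * c₂₂ - c₁₂ * c₂₁ with hδ
  have hδ0 : δ ≠ 0 := sub_ne_zero.mpr hdet
  -- A basis of the span of `P₁, P₂` that is dual to `Q₁, Q₂` up to the factor `δ`.
  set R₁ := c₂₂ • P₁ - c₁₂ • P₂ with hR₁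
  set R₂ := c₁₁ • P₂ - c₂₁ • P₁ with hR₂
  have hR₁E : ∀ i, ∀ v ∈ E i, R₁ v ∈ E (-q + i) := fun i v hv =>
    sub_mem (Submodule.smul_mem _ _ (hP₁ i v hv)) (Submodule.smul_mem _ _ (hP₂ i v hv))
  have hR₂E : ∀ i, ∀ v ∈ E i, R₂ v ∈ E (-q + i) := fun i v hv =>
    sub_mem (Submodule.smul_mem _ _ (hP₂ i v hv)) (Submodule.smul_mem _ _ (hP₁ i v hv))
  have k₁₁ : ∀ v ∈ ⨆ i, E i, R₁ (Q₁ v) - Q₁ (R₁ v) = δ • v := fun v hv => by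
    simp only [hR₁, LinearMap.sub_apply, LinearMap.smul_apply, map_sub, map_smul]
    linear_combination (norm := module) c₂₂ • h₁₁ v hv - c₁₂ • h₂₁ v hv
  have k₂₂ : ∀ v ∈ ⨆ i, E i, R₂ (Q₂ v) - Q₂ (R₂ v) = δ • v := fun v hv => by
    simp only [hR₂, LinearMap.sub_apply, LinearMap.smul_apply, map_sub, map_smul]
    linear_combination (norm := module) c₁₁ • h₂₂ v hv - c₂₁ • h₁₂ v hv
  have k₂₁ : ∀ v ∈ ⨆ i, E i, R₂ (Q₁ v) = Q₁ (R₂ v) := fun v hv => by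
    simp only [hR₂, LinearMap.sub_apply, LinearMap.smul_apply, map_sub, map_smul]
    linear_combination (norm := module) c₁₁ • h₂₁ v hv - c₂₁ • h₁₁ v hv
  have kP : ∀ v ∈ ⨆ i, E i, R₁ (R₂ v) = R₂ (R₁ v) := fun v hv => by
    simp only [hR₁, hR₂, LinearMap.sub_apply, LinearMap.smul_apply, map_sub, map_smul]
    linear_combination (norm := module) (c₂₂ * c₁₁ - c₁₂ * c₂₁) • hP v hv
  have hR₁F := iSup_mapsTo hR₁E
  have hR₂F := iSup_mapsTo hR₂E
  have hQ₁F := iSup_mapsTo hQ₁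
  have hQ₂F := iSup_mapsTo hQ₂
  -- Here `[Q₁R₁, Q₁R₂] = Q₁(R₁Q₁ - Q₁R₁)R₂ = δ Q₁R₂`, since `R₂` commutes with `Q₁` and `R₁`.
  have he := iSup_pow_eq_zero_of_commutator hn (D := Q₁ * R₁) (e := Q₁ * R₂)
    (fun i v hv => by simpa using hQ₁ _ _ (hR₁E i v hv))
    (fun i v hv => by simpa using hQ₁ _ _ (hR₂E i v hv)) hδ0 (fun v hv => by
      simp only [Module.End.mul_apply]
      rw [← map_sub, k₂₁ _ (hR₁F v hv), ← kP v hv, k₁₁ _ (hR₂F v hv), map_smul])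
  set r₁ := R₁.restrict hR₁F with hr₁
  set r₂ := R₂.restrict hR₂F with hr₂
  set s₁ := Q₁.restrict hQ₁F with hs₁
  set s₂ := Q₂.restrict hQ₂F with hs₂
  have hcomm : Commute s₁ r₂ := by
    ext ⟨v, hv⟩
    exact (k₂₁ v hv).symm
  have h1 : s₁ ^ n * r₂ ^ n = 0 := by
    rw [← hcomm.mul_pow]
    have : s₁ * r₂ = (Q₁ * R₂).restrict (fun v hv => hQ₁F _ (hR₂F v hv)) := rfl
    rw [this, Module.End.pow_restrict]
    ext ⟨v, hv⟩
    simpa using he v hv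
  -- Differentiating by `δ⁻¹ R₁` removes `Q₁^n`, leaving `R₂` nilpotent.
  have h2 : r₂ ^ n = 0 := by
    refine eq_zero_of_pow_mul_eq_zero (P := δ⁻¹ • r₁) ?_ ?_ h1
    · ext ⟨v, hv⟩
      have := k₁₁ v hv
      simp only [hr₁, hs₁, LinearMap.sub_apply, Module.End.mul_apply, Module.End.one_apply,
        LinearMap.smul_apply, map_smul, ← smul_sub]
      simp only [LinearMap.coe_restrict_apply, Submodule.coe_smul, Submodule.coe_sub]
      rw [this, smul_smul, inv_mul_cancel₀ hδ0, one_smul]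
    · have hc' : Commute r₁ r₂ := by
        ext ⟨v, hv⟩
        exact kP v hv
      exact ((hc'.smul_left δ⁻¹).pow_right n).eq
  -- A member of a Heisenberg pair cannot be nilpotent on a nonzero space: differentiating `R₂^n =
  -- 0` by `-δ⁻¹ Q₂` ends at `1 = 0`.
  have h3 : (1 : Module.End ℂ ↥(⨆ i, E i)) = 0 := by
    refine eq_zero_of_pow_mul_eq_zero (P := -δ⁻¹ • s₂) (Q := r₂) (n := n) ?_ (by rw [mul_one, one_mul])
      (by rw [h2, zero_mul])
    ext ⟨v, hv⟩
    have := k₂₂ v hv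
    simp only [hr₂, hs₂, LinearMap.sub_apply, Module.End.mul_apply, Module.End.one_apply,
      LinearMap.smul_apply, map_smul, ← smul_sub]
    simp only [LinearMap.coe_restrict_apply, Submodule.coe_smul, Submodule.coe_sub]
    rw [← neg_sub, this, neg_smul, smul_neg, neg_neg, smul_smul, inv_mul_cancel₀ hδ0, one_smul]
  obtain ⟨i, hi⟩ := hE
  obtain ⟨v, hv, hv0⟩ := Submodule.exists_mem_ne_zero_of_ne_bot hi
  exact hv0 (congrArg Subtype.val
    (LinearMap.congr_fun h3 ⟨v, Submodule.mem_iSup_of_mem i hv⟩))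

end Operators

/-! ### Heights, coroots and root spaces of `𝔤`. -/

section Roots

set_option linter.unusedSectionVars false

open LieAlgebra LieModule

variable {𝔤 : Type*} [LieRing 𝔤] [LieAlgebra ℂ 𝔤] [FiniteDimensional ℂ 𝔤]
  [LieAlgebra.IsSimple ℂ 𝔤] {H : LieSubalgebra ℂ 𝔤} [H.IsCartanSubalgebra]

/-- The element `ρ^∨` of the Cartan subalgebra on which every root takes its height as value. -/
theorem exists_height_element (base : (IsKilling.rootSystem H).Base) :
    ∃ ρ : H, ∀ α : H.root, α.1 ρ = (base.height α : ℂ) := by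
  let w : Module.Dual ℂ (Module.Dual ℂ H) := base.toWeightBasis.constr ℂ fun _ => (1 : ℂ)
  refine ⟨(Module.evalEquiv ℂ H).symm w, fun α => ?_⟩
  have h1 : ∀ φ : Module.Dual ℂ H, φ ((Module.evalEquiv ℂ H).symm w) = w φ := fun φ => by
    simp
  obtain ⟨f, hf⟩ := base.exists_root_eq_sum_int α
  rw [RootPairing.Base.height_eq_sum hf.2.2]
  have h2 : α.1 ((Module.evalEquiv ℂ H).symm w) = w ((IsKilling.rootSystem H).root α) :=
    h1 ((IsKilling.rootSystem H).root α)
  rw [h2, hf.2.2, map_sum, Int.cast_sum]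
  refine Finset.sum_congr rfl fun j hj => ?_
  rw [map_zsmul]
  have : w ((IsKilling.rootSystem H).root j) = 1 := by
    have := base.toWeightBasis.constr_basis ℂ (fun _ => (1 : ℂ)) ⟨j, hj⟩
    rwa [RootPairing.Base.toWeightBasis_apply] at this
  rw [this]
  simp

/-- The simple coroots form a basis of the Cartan subalgebra, so they already detect a nonzero
functional. -/
theorem exists_isPos_coroot_ne_zero (base : (IsKilling.rootSystem H).Base)
    {lam : Module.Dual ℂ H} (h : lam ≠ 0) :
    ∃ α : H.root, base.IsPos α ∧ lam (IsKilling.coroot α.1) ≠ 0 := by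
  by_contra! hcon
  apply h
  apply base.toCoweightBasis.ext
  intro i
  rw [RootPairing.Base.toCoweightBasis_apply]
  exact hcon i (base.isPos_of_mem_support i.2)

/-- Meant for brackets of root vectors, whose weight `γ = β - α` may fail to be a root; the case `x
= 0` absorbs this. -/
theorem rootSpace_cases (base : (IsKilling.rootSystem H).Base) {γ : H → ℂ} {x : 𝔤}
    (hx : x ∈ rootSpace H γ) : x = 0 ∨ (x ∈ H ∧ γ = 0) ∨
      (∃ α : H.root, base.IsPos α ∧ γ = α.1 ∧ x ∈ rootSpace H α.1) ∨
      ∃ α : H.root, base.IsPos α ∧ γ = -α.1 ∧ x ∈ rootSpace H (-α.1 : H → ℂ) := by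
  by_cases h0 : x = 0
  · exact Or.inl h0
  by_cases hγ : γ = 0
  · subst hγ
    refine Or.inr (Or.inl ⟨?_, rfl⟩)
    rwa [rootSpace_zero_eq, LieSubalgebra.mem_toLieSubmodule] at hx
  have hne : genWeightSpace 𝔤 γ ≠ ⊥ := by
    intro hb
    have : x ∈ genWeightSpace 𝔤 γ := hx
    rw [hb] at this
    exact h0 (by simpa using this)
  let α : Weight ℂ H 𝔤 := ⟨γ, hne⟩
  have hα : α.IsNonZero := hγ
  let α' : H.root := ⟨α, by simpa using hα⟩
  rcases RootPairing.Base.IsPos.or_neg base α' with hp | hp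
  · exact Or.inr (Or.inr (Or.inl ⟨α', hp, rfl, hx⟩))
  · let := (IsKilling.rootSystem H).indexNeg
    have hneg : ((-α' : H.root).1 : H → ℂ) = -γ := by
      ext y
      exact LinearMap.congr_fun ((RootPairing.root_eq_neg_iff (P := IsKilling.rootSystem H) (i := -α') (j := α')).mpr rfl) y
    refine Or.inr (Or.inr (Or.inr ⟨-α', hp, ?_, ?_⟩))
    · rw [hneg, neg_neg]
    · rwa [hneg, neg_neg]

theorem cartan_root_induction (base : (IsKilling.rootSystem H).Base) {P : 𝔤 → Prop}
    (hadd : ∀ x y, P x → P y → P (x + y)) (hH : ∀ x ∈ H, P x)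
    (hpos : ∀ α, base.IsPos α → ∀ x ∈ rootSpace H α.1, P x)
    (hneg : ∀ α, base.IsPos α → ∀ x ∈ rootSpace H (-α.1 : H → ℂ), P x) (x : 𝔤) : P x := by
  have hx : x ∈ (⨆ χ : H → ℂ, (genWeightSpace 𝔤 χ).toSubmodule) := by
    have := LieModule.iSup_genWeightSpace_eq_top ℂ H 𝔤
    rw [← LieSubmodule.toSubmodule_inj, LieSubmodule.iSup_toSubmodule] at this
    rw [this]
    trivial
  refine Submodule.iSup_induction _ (motive := P) hx (fun γ x hx => ?_) (hH 0 H.zero_mem) hadd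
  rcases rootSpace_cases base (γ := γ) hx with h | h | ⟨α, h, -, h'⟩ | ⟨α, h, -, h'⟩
  · rw [h]; exact hH 0 H.zero_mem
  · exact hH x h.1
  · exact hpos α h x h'
  · exact hneg α h x h'

theorem lie_mem_rootSpace_sub {α β : H → ℂ} {x y : 𝔤} (hx : x ∈ rootSpace H β)
    (hy : y ∈ rootSpace H (-α)) : ⁅x, y⁆ ∈ rootSpace H (β - α) := by
  rw [sub_eq_add_neg]
  exact lie_mem_genWeightSpace_of_mem_genWeightSpace hx hy

theorem lie_cartan_of_mem_rootSpace {α : H → ℂ} {h x : 𝔤} (hh : h ∈ H) (hx : x ∈ rootSpace H α) :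
    ⁅h, x⁆ = α ⟨h, hh⟩ • x :=
  IsKilling.lie_eq_smul_of_mem_rootSpace hx ⟨h, hh⟩

theorem lie_cartan_cartan {h h' : 𝔤} (hh : h ∈ H) (hh' : h' ∈ H) : ⁅h, h'⁆ = 0 := by
  have := lie_cartan_of_mem_rootSpace (α := 0) (x := h') hh (by
    rw [rootSpace_zero_eq, LieSubalgebra.mem_toLieSubmodule]; exact hh')
  simpa using this

/-- Invariance gives `0 = ([h, h'] | x) = α(h') (h | x)`, with `h'` chosen so that `α(h') ≠ 0`. This
removes the central term when `𝔥̇ ⊗ A` meets a root vector. -/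
theorem InvariantForm.eq_zero_of_mem_rootSpace (Φ : InvariantForm 𝔤) {α : H → ℂ} (hα : α ≠ 0)
    {h x : 𝔤} (hh : h ∈ H) (hx : x ∈ rootSpace H α) : Φ.form h x = 0 := by
  obtain ⟨h', hh'⟩ := Function.ne_iff.mp hα
  have h1 := Φ.invariant h h' x
  rw [lie_cartan_cartan hh h'.2, map_zero, LinearMap.zero_apply,
    lie_cartan_of_mem_rootSpace h'.2 hx, map_smul, smul_eq_mul] at h1
  exact (mul_eq_zero.mp h1.symm).resolve_left hh'

theorem exists_sl2_of_root (α : H.root) : ∃ e f : 𝔤,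
    IsSl2Triple ((IsKilling.coroot α.1 : H) : 𝔤) e f ∧ e ∈ rootSpace H α.1 ∧
      f ∈ rootSpace H (-α.1 : H → ℂ) := by
  have hα : α.1.IsNonZero := LieSubalgebra.isNonZero_coe_root α
  obtain ⟨h, e, f, ht, he, hf⟩ := IsKilling.exists_isSl2Triple_of_weight_isNonZero hα
  have := IsSl2Triple.h_eq_coroot hα ht he hf
  exact ⟨e, f, this ▸ ht, he, hf⟩

theorem exists_smul_of_mem_rootSpace (α : H.root) {f x : 𝔤} (hf : f ∈ rootSpace H (-α.1 : H → ℂ))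
    (hf0 : f ≠ 0) (hx : x ∈ rootSpace H (-α.1 : H → ℂ)) : ∃ c : ℂ, x = c • f := by
  have hα : (-α.1).IsNonZero := (LieSubalgebra.isNonZero_coe_root α).neg
  have h1 := IsKilling.finrank_rootSpace_eq_one (-α.1) hα
  rw [Weight.coe_neg] at h1
  obtain ⟨c, hc⟩ := (finrank_eq_one_iff_of_nonzero' (⟨f, hf⟩ : rootSpace H (-α.1 : H → ℂ))
    (by simpa [Subtype.ext_iff] using hf0)).mp h1 ⟨x, hx⟩
  exact ⟨c, (congrArg Subtype.val hc).symm⟩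

end Roots

/-! ### Triangular decomposition and the grading by `ρ^∨`. -/

section Triangular

set_option linter.unusedSectionVars false

open LieAlgebra LieModule

variable {𝔤 : Type*} [LieRing 𝔤] [LieAlgebra ℂ 𝔤] [FiniteDimensional ℂ 𝔤]
  [LieAlgebra.IsSimple ℂ 𝔤] {H : LieSubalgebra ℂ 𝔤} [H.IsCartanSubalgebra]
  {base : (LieAlgebra.IsKilling.rootSystem H).Base}
  {ν : ℕ} {Φ : InvariantForm 𝔤} {c₁ c₂ : ℂ} {B : Type*} [CommRing B] [Algebra ℂ B]
  {V : Type*} [AddCommGroup V] [Module ℂ V] [LieRingModule (TauB ν Φ c₁ c₂ B) V]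
  [LieModule ℂ (TauB ν Φ c₁ c₂ B) V]

local notation "XT" => xt ν Φ c₁ c₂
local notation "KT" => kt (𝔤 := 𝔤) ν Φ c₁ c₂
local notation "DT" => dt (𝔤 := 𝔤) ν Φ c₁ c₂
local notation "KST" => kst (𝔤 := 𝔤) ν Φ c₁ c₂

theorem kst_zero_right (m : Deg ν) (b : B) : KST m 0 b = 0 := by simp [kst]

theorem lie_xt_zero_xt (x y : 𝔤) (m : Deg ν) (b b' : B) :
    ⁅XT x 0 b, XT y m b'⁆ = XT ⁅x, y⁆ m (b * b') := by
  rw [lie_xt_xt, kst_zero_right, smul_zero, add_zero, zero_add]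

theorem lie_xt_zero_dt (x : 𝔤) (a : Fin (ν + 1)) (m : Deg ν) (b b' : B) :
    ⁅XT x 0 b, DT m a b'⁆ = 0 := by
  rw [← lie_skew, lie_dt_xt]
  simp

theorem lie_kst_mem {S : Submodule ℂ V} {v : V} (hk : ∀ m p (b : B), ⁅KT m p b, v⁆ ∈ S)
    (m u : Deg ν) (b : B) : ⁅KST m u b, v⁆ ∈ S := by
  rw [kst, sum_lie]
  exact sum_mem fun p _ => by rw [tauB_smul_lie]; exact S.smul_mem _ (hk m p b)

variable (H ν Φ c₁ c₂ B) in
/-- Subspaces stable under the zero part `(𝔥 ⊗ A ⊕ 𝒦 ⊕ 𝒟) ⊗ B` of the triangular decomposition. -/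
structure IsZeroStable (S : Submodule ℂ V) : Prop where
  xt : ∀ h ∈ H, ∀ m (b : B), ∀ v ∈ S, ⁅xt ν Φ c₁ c₂ h m b, v⁆ ∈ S
  kt : ∀ m p (b : B), ∀ v ∈ S, ⁅kt ν Φ c₁ c₂ m p b, v⁆ ∈ S
  dt : ∀ m a (b : B), ∀ v ∈ S, ⁅dt ν Φ c₁ c₂ m a b, v⁆ ∈ S

theorem IsZeroStable.inf {S S' : Submodule ℂ V} (h : IsZeroStable H ν Φ c₁ c₂ B S)
    (h' : IsZeroStable H ν Φ c₁ c₂ B S') : IsZeroStable H ν Φ c₁ c₂ B (S ⊓ S') where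
  xt x hx m b v hv := ⟨h.xt x hx m b v hv.1, h'.xt x hx m b v hv.2⟩
  kt m p b v hv := ⟨h.kt m p b v hv.1, h'.kt m p b v hv.2⟩
  dt m a b v hv := ⟨h.dt m a b v hv.1, h'.dt m a b v hv.2⟩

theorem root_ne_zero (α : H.root) : (α.1 : H → ℂ) ≠ 0 := fun hα =>
  LieSubalgebra.isNonZero_coe_root α hα

/-- The zero part normalizes `𝔤₊ ⊗ A ⊗ B`: the bracket with `𝒦` vanishes, and Cartan elements
produce no central term. -/
theorem isZeroStable_topSpace : IsZeroStable H ν Φ c₁ c₂ B (topSpace ν Φ c₁ c₂ B V base) where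
  xt h hh m b v hv α hα x hx n b' := by
    rw [leibniz_lie, hv α hα x hx n b', lie_zero, add_zero, lie_xt_xt, Φ.symm,
      Φ.eq_zero_of_mem_rootSpace (root_ne_zero α) hh hx, zero_smul, add_zero]
    apply hv α hα
    rw [← lie_skew, lie_cartan_of_mem_rootSpace hh hx]
    exact neg_mem (Submodule.smul_mem _ _ hx)
  kt m p b v hv α hα x hx n b' := by
    rw [leibniz_lie, hv α hα x hx n b', lie_zero, add_zero, lie_xt_kt, zero_lie]
  dt m a b v hv α hα x hx n b' := by
    rw [leibniz_lie, hv α hα x hx n b', lie_zero, add_zero, ← lie_skew, lie_dt_xt, neg_lie,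
      tauB_smul_lie, hv α hα x hx, smul_zero, neg_zero]

/-- An element of degree zero that is central in the zero part has stable eigenspaces. -/
theorem isZeroStable_eigenspace {z : TauB ν Φ c₁ c₂ B}
    (hx : ∀ h ∈ H, ∀ m (b : B), ⁅z, XT h m b⁆ = 0) (hk : ∀ m p (b : B), ⁅z, KT m p b⁆ = 0)
    (hd : ∀ m a (b : B), ⁅z, DT m a b⁆ = 0) (c : ℂ) :
    IsZeroStable H ν Φ c₁ c₂ B (Module.End.eigenspace (toEnd ℂ (TauB ν Φ c₁ c₂ B) V z) c) := by
  have key : ∀ y : TauB ν Φ c₁ c₂ B, ⁅z, y⁆ = 0 → ∀ v,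
      v ∈ Module.End.eigenspace (toEnd ℂ (TauB ν Φ c₁ c₂ B) V z) c →
      ⁅y, v⁆ ∈ Module.End.eigenspace (toEnd ℂ (TauB ν Φ c₁ c₂ B) V z) c := by
    intro y hy v hv
    rw [Module.End.mem_eigenspace_iff, toEnd_apply_apply] at hv ⊢
    rw [leibniz_lie, hy, zero_lie, zero_add, hv, lie_smul]
  exact ⟨fun h hh m b => key _ (hx h hh m b), fun m p b => key _ (hk m p b),
    fun m a b => key _ (hd m a b)⟩

theorem isZeroStable_eigenspace_xt {h : 𝔤} (hh : h ∈ H) (b : B) (c : ℂ) :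
    IsZeroStable H ν Φ c₁ c₂ B
      (Module.End.eigenspace (toEnd ℂ (TauB ν Φ c₁ c₂ B) V (XT h 0 b)) c) :=
  isZeroStable_eigenspace
    (fun h' hh' m b' => by rw [lie_xt_zero_xt, lie_cartan_cartan hh hh', xt_zero_left])
    (fun m p b' => lie_xt_kt _ _ _ _ _ _) (fun m a b' => lie_xt_zero_dt _ _ _ _ _) c

variable (ν Φ c₁ c₂ B base) in
/-- The span of the vectors obtained from a subspace by applying `𝔤₋ ⊗ A ⊗ B` repeatedly. -/
inductive LowerSpan (S : Submodule ℂ V) : V → Prop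
  | of (v : V) (hv : v ∈ S) : LowerSpan S v
  | add (v w : V) (hv : LowerSpan S v) (hw : LowerSpan S w) : LowerSpan S (v + w)
  | smul (c : ℂ) (v : V) (hv : LowerSpan S v) : LowerSpan S (c • v)
  | lower (α : H.root) (hα : base.IsPos α) (x : 𝔤) (hx : x ∈ rootSpace H (-α.1 : H → ℂ))
      (m : Deg ν) (b : B) (v : V) (hv : LowerSpan S v) : LowerSpan S ⁅xt ν Φ c₁ c₂ x m b, v⁆

variable (ν Φ c₁ c₂ B base) in
/-- `LowerSpan` as a submodule. -/
def lowerSpan (S : Submodule ℂ V) : Submodule ℂ V where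
  carrier := {v | LowerSpan base ν Φ c₁ c₂ B S v}
  zero_mem' := .of 0 S.zero_mem
  add_mem' := .add _ _
  smul_mem' c v := .smul c v

/-- A substitute for PBW: each generator is commuted past the leftmost lowering operator. The four
assertions need a joint induction because the commutators mix the types of generators. -/
theorem lowerSpan_stable {S : Submodule ℂ V} (hS : IsZeroStable H ν Φ c₁ c₂ B S)
    (htop : S ≤ topSpace ν Φ c₁ c₂ B V base) {v : V} (hv : LowerSpan base ν Φ c₁ c₂ B S v) :
    (∀ h ∈ H, ∀ m (b : B), ⁅XT h m b, v⁆ ∈ lowerSpan base ν Φ c₁ c₂ B S) ∧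
    (∀ α, base.IsPos α → ∀ x ∈ rootSpace H α.1, ∀ m (b : B),
      ⁅XT x m b, v⁆ ∈ lowerSpan base ν Φ c₁ c₂ B S) ∧
    (∀ m p (b : B), ⁅KT m p b, v⁆ ∈ lowerSpan base ν Φ c₁ c₂ B S) ∧
    (∀ m a (b : B), ⁅DT m a b, v⁆ ∈ lowerSpan base ν Φ c₁ c₂ B S) := by
  induction hv with
  | of v hv =>
    refine ⟨fun h hh m b => .of _ (hS.xt h hh m b v hv), fun α hα x hx m b => ?_,
      fun m p b => .of _ (hS.kt m p b v hv), fun m a b => .of _ (hS.dt m a b v hv)⟩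
    rw [htop hv α hα x hx m b]
    exact zero_mem _
  | add v w _ _ hv hw =>
    refine ⟨fun h hh m b => ?_, fun α hα x hx m b => ?_, fun m p b => ?_, fun m a b => ?_⟩ <;>
      rw [lie_add]
    exacts [add_mem (hv.1 h hh m b) (hw.1 h hh m b),
      add_mem (hv.2.1 α hα x hx m b) (hw.2.1 α hα x hx m b),
      add_mem (hv.2.2.1 m p b) (hw.2.2.1 m p b), add_mem (hv.2.2.2 m a b) (hw.2.2.2 m a b)]
  | smul c v _ hv =>
    refine ⟨fun h hh m b => ?_, fun α hα x hx m b => ?_, fun m p b => ?_, fun m a b => ?_⟩ <;>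
      rw [lie_smul] <;> apply Submodule.smul_mem
    exacts [hv.1 h hh m b, hv.2.1 α hα x hx m b, hv.2.2.1 m p b, hv.2.2.2 m a b]
  | lower α hα x hx m b v hv ih =>
    obtain ⟨ih1, ih2, ih3, ih4⟩ := ih
    have hlow : ∀ w ∈ lowerSpan base ν Φ c₁ c₂ B S,
        ⁅XT x m b, w⁆ ∈ lowerSpan base ν Φ c₁ c₂ B S := fun w hw => LowerSpan.lower α hα x hx m b w hw
    refine ⟨fun h hh n b' => ?_, fun β hβ y hy n b' => ?_, fun n p b' => ?_, fun n a b' => ?_⟩ <;>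
      rw [leibniz_lie]
    · refine add_mem ?_ (hlow _ (ih1 h hh n b'))
      rw [lie_xt_xt, lie_cartan_of_mem_rootSpace hh hx, add_lie, xt_smul_left, tauB_smul_lie, tauB_smul_lie]
      exact add_mem (Submodule.smul_mem _ _ (LowerSpan.lower α hα x hx _ _ v hv))
        (Submodule.smul_mem _ _ (lie_kst_mem ih3 _ _ _))
    · refine add_mem ?_ (hlow _ (ih2 β hβ y hy n b'))
      rw [lie_xt_xt, add_lie, tauB_smul_lie]
      refine add_mem ?_ (Submodule.smul_mem _ _ (lie_kst_mem ih3 _ _ _))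
      -- `[𝔤_β, 𝔤_{-α}]` may be zero or land in the Cartan, positive or negative part; the inductive
      -- data cover every case.
      rcases rootSpace_cases base (lie_mem_rootSpace_sub hy hx) with h | h | h | h
      · rw [h, xt_zero_left, zero_lie]
        exact zero_mem _
      · exact ih1 _ h.1 _ _
      · obtain ⟨γ, hγ, -, h⟩ := h
        exact ih2 γ hγ _ h _ _
      · obtain ⟨γ, hγ, -, h⟩ := h
        exact LowerSpan.lower γ hγ _ h _ _ v hv
    · refine add_mem ?_ (hlow _ (ih3 n p b'))
      rw [← lie_skew, lie_xt_kt, neg_zero, zero_lie]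
      exact zero_mem _
    · refine add_mem ?_ (hlow _ (ih4 n a b'))
      rw [lie_dt_xt, tauB_smul_lie]
      exact Submodule.smul_mem _ _ (LowerSpan.lower α hα x hx _ _ v hv)

theorem lowerSpan_eq_top (hirr : LieModule.IsIrreducible ℂ (TauB ν Φ c₁ c₂ B) V)
    {S : Submodule ℂ V} (hS : IsZeroStable H ν Φ c₁ c₂ B S)
    (htop : S ≤ topSpace ν Φ c₁ c₂ B V base) (hne : S ≠ ⊥) :
    lowerSpan base ν Φ c₁ c₂ B S = ⊤ := by
  refine eq_top_of_stable hirr _ ?_ (fun x m b v hv => ?_)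
    (fun m p b v hv => (lowerSpan_stable hS htop hv).2.2.1 m p b)
    (fun m a b v hv => (lowerSpan_stable hS htop hv).2.2.2 m a b)
  · obtain ⟨v, hv, hv0⟩ := Submodule.exists_mem_ne_zero_of_ne_bot hne
    intro h
    have : v ∈ lowerSpan base ν Φ c₁ c₂ B S := .of v hv
    rw [h] at this
    exact hv0 (by simpa using this)
  · induction x using cartan_root_induction base with
    | hadd x y hx hy => rw [xt_add_left, add_lie]; exact add_mem hx hy
    | hH x hx => exact (lowerSpan_stable hS htop hv).1 x hx m b
    | hpos α hα x hx => exact (lowerSpan_stable hS htop hv).2.1 α hα x hx m b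
    | hneg α hα x hx => exact LowerSpan.lower α hα x hx m b v hv

theorem lie_xt_mem_eigenspace {h x : 𝔤} {c d : ℂ} (hx : ⁅h, x⁆ = c • x) (m : Deg ν) (b : B) {v : V}
    (hv : v ∈ Module.End.eigenspace (toEnd ℂ (TauB ν Φ c₁ c₂ B) V (XT h 0 1)) d) :
    ⁅XT x m b, v⁆ ∈
      Module.End.eigenspace (toEnd ℂ (TauB ν Φ c₁ c₂ B) V (XT h 0 (1 : B))) (d + c) := by
  rw [Module.End.mem_eigenspace_iff, toEnd_apply_apply] at hv ⊢
  rw [leibniz_lie, hv, lie_xt_zero_xt, hx, xt_smul_left, one_mul, tauB_smul_lie, lie_smul, ← add_smul,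
    add_comm]

variable {ρ : H} (hρ : ∀ α : H.root, α.1 ρ = (base.height α : ℂ))

include hρ in
-- A positive height is written `k + 1`, so that strictly lower eigenvalues are indexed by all of
-- `ℕ`.
theorem lie_height_element {α : H.root} (hα : base.IsPos α) {x : 𝔤}
    (hx : x ∈ rootSpace H (-α.1 : H → ℂ)) : ∃ k : ℕ, base.height α = k + 1 ∧
      ⁅(ρ : 𝔤), x⁆ = (-((k : ℂ) + 1)) • x := by
  obtain ⟨k, hk⟩ := Int.eq_ofNat_of_zero_le (Int.le_sub_one_of_lt hα)
  have hk' : base.height α = k + 1 := by simpa [sub_eq_iff_eq_add] using hk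
  refine ⟨k, hk', ?_⟩
  rw [lie_cartan_of_mem_rootSpace ρ.2 hx, Pi.neg_apply]
  have := hρ α
  rw [hk'] at this
  rw [show (⟨(ρ : 𝔤), ρ.2⟩ : H) = ρ from rfl, this]
  push_cast
  rfl

local notation "ES" => Module.End.eigenspace (toEnd ℂ (TauB ν Φ c₁ c₂ B) V (XT (ρ : 𝔤) 0 (1 : B)))

include hρ in
theorem lowerSpan_le {S : Submodule ℂ V} {c : ℂ} (hc : S ≤ ES c) :
    lowerSpan base ν Φ c₁ c₂ B S ≤ S ⊔ ⨆ k : ℕ, ES (c - (k + 1)) := by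
  intro v hv
  induction hv with
  | of v hv => exact Submodule.mem_sup_left hv
  | add v w _ _ hv hw => exact add_mem hv hw
  | smul c v _ hv => exact Submodule.smul_mem _ _ hv
  | lower α hα x hx m b v _ hv =>
    obtain ⟨k, -, hk⟩ := lie_height_element hρ hα hx
    obtain ⟨s, hs, w, hw, rfl⟩ := Submodule.mem_sup.mp hv
    rw [lie_add]
    refine Submodule.mem_sup_right (add_mem ?_ ?_)
    · refine Submodule.mem_iSup_of_mem k ?_
      rw [sub_eq_add_neg]
      exact lie_xt_mem_eigenspace hk m b (hc hs)
    · refine Submodule.iSup_induction _ (motive := fun w => ⁅XT x m b, w⁆ ∈ _) hw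
        (fun j w hw => ?_) (by simp) (fun w w' hw hw' => by rw [lie_add]; exact add_mem hw hw')
      -- Index `j` carries the shift `j + 1`, and the total shift is `(j + 1) + (k + 1) = (j + k +
      -- 1) + 1`.
      refine Submodule.mem_iSup_of_mem (j + k + 1) ?_
      have := lie_xt_mem_eigenspace hk m b hw
      convert this using 2
      push_cast
      ring

include hρ in
/-- A subspace of `T ∩ V_c` stable under the zero part is all of `V_c`. -/
theorem eigenspace_le_of_stable (hirr : LieModule.IsIrreducible ℂ (TauB ν Φ c₁ c₂ B) V)
    {S : Submodule ℂ V} (hS : IsZeroStable H ν Φ c₁ c₂ B S)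
    (htop : S ≤ topSpace ν Φ c₁ c₂ B V base) (hne : S ≠ ⊥) {c : ℂ} (hc : S ≤ ES c) :
    ES c ≤ S := by
  intro v hv
  have h1 := lowerSpan_le hρ hc
  rw [lowerSpan_eq_top hirr hS htop hne] at h1
  obtain ⟨s, hs, w, hw, rfl⟩ := Submodule.mem_sup.mp (h1 (Submodule.mem_top (x := v)))
  -- The lower component `w` also has eigenvalue `c`, so independence of eigenspaces makes it
  -- vanish.
  have hw' : w ∈ ES c := by simpa using sub_mem hv (hc hs)
  have hdis := Module.End.eigenspaces_iSupIndep (toEnd ℂ (TauB ν Φ c₁ c₂ B) V (XT (ρ : 𝔤) 0 1)) c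
  have hle : (⨆ k : ℕ, ES (c - (k + 1))) ≤ ⨆ d, ⨆ (_ : d ≠ c), ES d :=
    iSup_le fun k => le_iSup₂_of_le (c - (k + 1)) (by
      rw [Ne, sub_eq_self]; exact Nat.cast_add_one_ne_zero k) le_rfl
  have hw0 : w = 0 := by
    have := Submodule.disjoint_def.mp hdis w hw' (hle hw)
    exact this
  rw [hw0, add_zero]
  exact hs

include hρ in
/-- The eigenvalues of `ρ^∨` on `V` lie in `c - ℕ`, where `c` is one on a vector of `T`. -/
theorem eigenvalue_of_stable (hirr : LieModule.IsIrreducible ℂ (TauB ν Φ c₁ c₂ B) V)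
    {S : Submodule ℂ V} (hS : IsZeroStable H ν Φ c₁ c₂ B S)
    (htop : S ≤ topSpace ν Φ c₁ c₂ B V base) (hne : S ≠ ⊥) {c : ℂ} (hc : S ≤ ES c)
    {d : ℂ} (hd : ES d ≠ ⊥) : ∃ k : ℕ, d = c - k := by
  by_contra! hcon
  apply hd
  have h1 := lowerSpan_le hρ hc
  rw [lowerSpan_eq_top hirr hS htop hne] at h1
  have hdis := Module.End.eigenspaces_iSupIndep (toEnd ℂ (TauB ν Φ c₁ c₂ B) V (XT (ρ : 𝔤) 0 1)) d
  have hle : S ⊔ (⨆ k : ℕ, ES (c - (k + 1))) ≤ ⨆ d', ⨆ (_ : d' ≠ d), ES d' := by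
    refine sup_le (le_iSup₂_of_le c ?_ hc)
      (iSup_le fun k => le_iSup₂_of_le (c - (k + 1)) ?_ le_rfl)
    · simpa using (hcon 0).symm
    · simpa using (hcon (k + 1)).symm
  exact hdis.eq_bot_of_le ((le_top.trans h1).trans hle)

end Triangular

/-! ### Weight vectors, the irreducible top `E`, and its grading. -/

section Top

set_option linter.unusedSectionVars false

open LieAlgebra LieModule

variable {𝔤 : Type*} [LieRing 𝔤] [LieAlgebra ℂ 𝔤] [FiniteDimensional ℂ 𝔤]
  [LieAlgebra.IsSimple ℂ 𝔤] {H : LieSubalgebra ℂ 𝔤} [H.IsCartanSubalgebra]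
  {base : (LieAlgebra.IsKilling.rootSystem H).Base}
  {ν : ℕ} {Φ : InvariantForm 𝔤} {c₁ c₂ : ℂ} {B : Type*} [CommRing B] [Algebra ℂ B]
  {V : Type*} [AddCommGroup V] [Module ℂ V] [LieRingModule (TauB ν Φ c₁ c₂ B) V]
  [LieModule ℂ (TauB ν Φ c₁ c₂ B) V]

local notation "XT" => xt ν Φ c₁ c₂
local notation "KT" => kt (𝔤 := 𝔤) ν Φ c₁ c₂
local notation "DT" => dt (𝔤 := 𝔤) ν Φ c₁ c₂
local notation "WS" => weightSpace H ν Φ c₁ c₂ B V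

theorem cartanElt_fst (h : H) : cartanElt H ν Φ c₁ c₂ B (h, 0, 0) = XT (h : 𝔤) 0 1 := by
  simp [cartanElt]

theorem cartanElt_der (i : Fin (ν + 1)) :
    cartanElt H ν Φ c₁ c₂ B (0, 0, Pi.single i 1) = DT 0 i 1 := by
  simp [cartanElt, xt_zero_left, Pi.single_apply, ite_smul]

theorem mem_weightSpace_iff {lam : Module.Dual ℂ (Cartan H ν)} {v : V} : v ∈ WS lam ↔
    (∀ h : H, ⁅XT (h : 𝔤) 0 (1 : B), v⁆ = lam (h, 0, 0) • v) ∧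
    (∀ i, ⁅KT 0 i (1 : B), v⁆ = lam (0, Pi.single i 1, 0) • v) ∧
    (∀ i, ⁅DT 0 i (1 : B), v⁆ = lam (0, 0, Pi.single i 1) • v) := by
  constructor
  · intro hv
    refine ⟨fun h => ?_, fun i => ?_, fun i => ?_⟩
    · rw [← cartanElt_fst]
      exact hv _
    · have : cartanElt H ν Φ c₁ c₂ B (0, Pi.single i 1, 0) = KT 0 i 1 := by
        simp [cartanElt, xt_zero_left, Pi.single_apply, ite_smul]
      rw [← this]
      exact hv _
    · rw [← cartanElt_der (H := H)]
      exact hv _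
  · rintro ⟨hx, hk, hd⟩ ⟨h, u, w⟩
    have h1 : ((h, u, w) : Cartan H ν) =
        (h, 0, 0) + ∑ i, u i • ((0 : H), (Pi.single i (1 : ℂ) : Fin (ν + 1) → ℂ), (0 : Fin (ν + 1) → ℂ))
          + ∑ i, w i • ((0 : H), (0 : Fin (ν + 1) → ℂ), (Pi.single i (1 : ℂ) : Fin (ν + 1) → ℂ)) := by
      ext j <;> simp [Prod.fst_sum, Prod.snd_sum, Finset.sum_apply, Pi.single_apply]
    rw [h1, map_add, map_add, map_sum, map_sum, ← h1]
    simp only [cartanElt, add_lie, sum_lie, tauB_smul_lie, hx, hk, hd, map_smul, add_smul,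
      Finset.sum_smul, smul_smul, smul_eq_mul]

/-- The operator `h - λ₀(h)` kills the component of weight `λ₀` and rescales the others; choosing
`h` to separate `λ₀` from a given weight lets the induction recover that component. -/
theorem mem_of_sum_mem {S : Submodule ℂ V}
    (hS : ∀ h : Cartan H ν, ∀ v ∈ S, ⁅cartanElt H ν Φ c₁ c₂ B h, v⁆ ∈ S)
    (s : Finset (Module.Dual ℂ (Cartan H ν))) (v : Module.Dual ℂ (Cartan H ν) → V)
    (hv : ∀ lam, v lam ∈ WS lam) (hsum : ∑ lam ∈ s, v lam ∈ S) : ∀ lam ∈ s, v lam ∈ S := by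
  classical
  induction s using Finset.induction_on generalizing v with
  | empty => simp
  | insert lam₀ s h0 ih =>
    have key : ∀ lam ∈ s, v lam ∈ S := by
      intro lam hlam
      obtain ⟨h, hh⟩ : ∃ h, lam h ≠ lam₀ h := by
        by_contra! hcon
        exact h0 (LinearMap.ext hcon ▸ hlam)
      have h1 := ih (fun lam => (lam h - lam₀ h) • v lam)
        (fun lam => Submodule.smul_mem _ _ (hv lam)) (by
          have h2 := sub_mem (hS h _ hsum) (S.smul_mem (lam₀ h) hsum)
          rw [Finset.sum_insert h0, lie_add, hv lam₀ h, smul_add, add_sub_add_left_eq_sub,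
            lie_sum, Finset.smul_sum, ← Finset.sum_sub_distrib] at h2
          convert h2 using 2 with lam' _
          rw [hv lam' h, sub_smul]) lam hlam
      have h3 := S.smul_mem (lam h - lam₀ h)⁻¹ h1
      rwa [smul_smul, inv_mul_cancel₀ (sub_ne_zero.mpr hh), one_smul] at h3
    intro lam hlam
    rcases Finset.mem_insert.mp hlam with h | hlam
    · rw [h]
      rw [Finset.sum_insert h0] at hsum
      simpa using sub_mem hsum (sum_mem key)
    · exact key lam hlam

/-- A nonzero subspace stable under `𝔥` contains a weight vector. -/
theorem exists_weight_vector (hfin : IsCfin H ν Φ c₁ c₂ B V) {S : Submodule ℂ V}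
    (hS : IsZeroStable H ν Φ c₁ c₂ B S) (hne : S ≠ ⊥) :
    ∃ lam, ∃ v ∈ S, v ∈ WS lam ∧ v ≠ 0 := by
  have hS' : ∀ h : Cartan H ν, ∀ v ∈ S, ⁅cartanElt H ν Φ c₁ c₂ B h, v⁆ ∈ S := by
    intro h v hv
    rw [cartanElt, add_lie, add_lie, sum_lie, sum_lie]
    refine add_mem (add_mem (hS.xt _ h.1.2 _ _ v hv) (sum_mem fun i _ => ?_))
      (sum_mem fun i _ => ?_) <;> rw [tauB_smul_lie] <;> apply S.smul_mem
    exacts [hS.kt _ _ _ v hv, hS.dt _ _ _ v hv]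
  obtain ⟨v, hv, hv0⟩ := Submodule.exists_mem_ne_zero_of_ne_bot hne
  classical
  have htop := hfin.weight.submodule_iSup_eq_top
  have hv' : v ∈ ⨆ lam, WS lam := htop ▸ Submodule.mem_top
  obtain ⟨f, hf, hsum⟩ := (Submodule.mem_iSup_iff_exists_finsupp _ _).mp hv'
  have h1 := mem_of_sum_mem hS' f.support f hf (by
    rw [Finsupp.sum] at hsum
    rw [hsum]
    exact hv)
  have hf0 : f.support.Nonempty := by
    rw [Finset.nonempty_iff_ne_empty]
    intro h
    rw [Finsupp.sum, h, Finset.sum_empty] at hsum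
    exact hv0 hsum.symm
  obtain ⟨lam, hlam⟩ := hf0
  exact ⟨lam, f lam, h1 lam hlam, hf lam, Finsupp.mem_support_iff.mp hlam⟩

variable (base ν Φ c₁ c₂ B) in
/-- A nonzero subspace of `T` that is irreducible under the zero part and is moved out of `T` by
`𝔤₋ ⊗ A ⊗ B`. -/
structure IsTop (E : Submodule ℂ V) : Prop where
  ne_bot : E ≠ ⊥
  stable : IsZeroStable H ν Φ c₁ c₂ B E
  le_top : E ≤ topSpace ν Φ c₁ c₂ B V base
  irred : ∀ S : Submodule ℂ V, IsZeroStable H ν Φ c₁ c₂ B S → S ⊓ E ≠ ⊥ → E ≤ S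
  lower : ∀ α, base.IsPos α → ∀ x ∈ rootSpace H (-α.1 : H → ℂ), ∀ m (b : B), ∀ v ∈ E,
    ⁅xt ν Φ c₁ c₂ x m b, v⁆ ∈ topSpace ν Φ c₁ c₂ B V base → ⁅xt ν Φ c₁ c₂ x m b, v⁆ = 0

/-- `E` is the intersection of `T` with a `ρ^∨`-eigenspace. Irreducibility holds because a stable
nonzero subspace of `E` exhausts that eigenspace. A nonzero vector of `T` obtained by lowering would
generate `V` from a strictly smaller eigenvalue, so `c` could not occur. -/
theorem exists_isTop (hirr : LieModule.IsIrreducible ℂ (TauB ν Φ c₁ c₂ B) V)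
    (hfin : IsCfin H ν Φ c₁ c₂ B V) (hT : topSpace ν Φ c₁ c₂ B V base ≠ ⊥) :
    ∃ E : Submodule ℂ V, IsTop base ν Φ c₁ c₂ B E := by
  obtain ⟨ρ, hρ⟩ := exists_height_element base
  obtain ⟨lam, z, hzT, hz, hz0⟩ := exists_weight_vector hfin isZeroStable_topSpace hT
  set c := lam (ρ, 0, 0) with hc
  have hst : ∀ d, IsZeroStable H ν Φ c₁ c₂ B (topSpace ν Φ c₁ c₂ B V base ⊓
      Module.End.eigenspace (toEnd ℂ (TauB ν Φ c₁ c₂ B) V (XT (ρ : 𝔤) 0 (1 : B))) d) := fun d =>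
    isZeroStable_topSpace.inf (isZeroStable_eigenspace_xt ρ.2 1 d)
  have hzE : z ∈ topSpace ν Φ c₁ c₂ B V base ⊓
      Module.End.eigenspace (toEnd ℂ (TauB ν Φ c₁ c₂ B) V (XT (ρ : 𝔤) 0 (1 : B))) c := by
    refine ⟨hzT, ?_⟩
    exact Module.End.mem_eigenspace_iff.mpr ((mem_weightSpace_iff.mp hz).1 ρ)
  refine ⟨_, ⟨fun h => ?_, hst c, inf_le_left, fun S hS hne => ?_, fun α hα x hx m b v hv hw => ?_⟩⟩
  · rw [h] at hzE
    exact hz0 (by simpa using hzE)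
  · refine inf_le_right.trans ((eigenspace_le_of_stable (S := S ⊓ _) hρ hirr (hS.inf (hst c))
      (inf_le_right.trans inf_le_left) hne (inf_le_right.trans inf_le_right)).trans inf_le_left)
  · by_contra hw0
    obtain ⟨k, -, hk⟩ := lie_height_element hρ hα hx
    have hmem := lie_xt_mem_eigenspace hk m b hv.2
    obtain ⟨j, hj⟩ := eigenvalue_of_stable hρ hirr (hst _) inf_le_left (fun h => hw0 (by
      have : ⁅XT x m b, v⁆ ∈ topSpace ν Φ c₁ c₂ B V base ⊓ _ := ⟨hw, hmem⟩
      -- Were the lower part of `T` zero, the vector would vanish; hence `c = c - (k + 1) - j` for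
      -- some natural `j`, which is absurd.
      rw [h] at this
      simpa using this)) inf_le_right (d := c) (fun h => hz0 (by
      have := hzE.2
      rw [h] at this
      simpa using this))
    have : ((k + 1 + j : ℕ) : ℂ) = 0 := by
      push_cast
      linear_combination hj
    exact absurd (Nat.cast_eq_zero.mp this) (by omega)

namespace IsTop

variable {E : Submodule ℂ V}

/-- Schur's lemma: `z` preserves a nonzero finite-dimensional `E ∩ V_λ`, so it has an eigenvector
there, and its eigenspace is stable under the zero part. -/
theorem exists_scalar (hE : IsTop base ν Φ c₁ c₂ B E) (hfin : IsCfin H ν Φ c₁ c₂ B V)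
    {z : TauB ν Φ c₁ c₂ B} (hzE : ∀ v ∈ E, ⁅z, v⁆ ∈ E)
    (hx : ∀ h ∈ H, ∀ m (b : B), ⁅z, XT h m b⁆ = 0) (hk : ∀ m p (b : B), ⁅z, KT m p b⁆ = 0)
    (hd : ∀ m a (b : B), ⁅z, DT m a b⁆ = 0) : ∃ c : ℂ, ∀ v ∈ E, ⁅z, v⁆ = c • v := by
  obtain ⟨lam, v₀, hv₀E, hv₀, hne⟩ := exists_weight_vector hfin hE.stable hE.ne_bot
  have := hfin.finite lam
  have hcomm : ∀ h, ⁅cartanElt H ν Φ c₁ c₂ B h, z⁆ = 0 := by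
    intro h
    rw [← lie_skew, cartanElt, lie_add, lie_add, hx _ h.1.2, lie_sum, lie_sum]
    simp [tauB_lie_smul, hk, hd]
  have hzW : ∀ v ∈ E ⊓ WS lam, toEnd ℂ (TauB ν Φ c₁ c₂ B) V z v ∈ E ⊓ WS lam := by
    rintro v ⟨hv, hv'⟩
    refine ⟨hzE v hv, fun h => ?_⟩
    rw [toEnd_apply_apply, leibniz_lie, hcomm, zero_lie, zero_add, hv' h, lie_smul]
  have : FiniteDimensional ℂ ↥(E ⊓ WS lam) :=
    Submodule.finiteDimensional_of_le inf_le_right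
  have : Nontrivial ↥(E ⊓ WS lam) :=
    ⟨⟨⟨v₀, hv₀E, hv₀⟩, 0, fun h => hne (congrArg Subtype.val h)⟩⟩
  obtain ⟨c, hc⟩ := Module.End.exists_eigenvalue ((toEnd ℂ (TauB ν Φ c₁ c₂ B) V z).restrict hzW)
  obtain ⟨w, hw⟩ := hc.exists_hasEigenvector
  refine ⟨c, fun v hv => ?_⟩
  have h1 := hE.irred _ (isZeroStable_eigenspace hx hk hd c) (fun h => hw.2 (by
    have : (w : V) ∈ Module.End.eigenspace (toEnd ℂ (TauB ν Φ c₁ c₂ B) V z) c ⊓ E := by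
      exact ⟨Module.End.mem_eigenspace_iff.mpr (congrArg Subtype.val hw.apply_eq_smul), w.2.1⟩
    rw [h] at this
    exact Subtype.ext (by simpa using this)))
  simpa [Module.End.mem_eigenspace_iff] using h1 hv

theorem exists_scalar_xt (hE : IsTop base ν Φ c₁ c₂ B E) (hfin : IsCfin H ν Φ c₁ c₂ B V)
    {h : 𝔤} (hh : h ∈ H) (b : B) : ∃ c : ℂ, ∀ v ∈ E, ⁅XT h 0 b, v⁆ = c • v :=
  hE.exists_scalar hfin (hE.stable.xt h hh 0 b)
    (fun h' hh' m b' => by rw [lie_xt_zero_xt, lie_cartan_cartan hh hh', xt_zero_left])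
    (fun m p b' => lie_xt_kt _ _ _ _ _ _) (fun m a b' => lie_xt_zero_dt _ _ _ _ _)

end IsTop

variable (ν Φ c₁ c₂ B) in
/-- The part of `E` on which `d_i` acts by `μ_i + m_i`. -/
def gradedPiece (E : Submodule ℂ V) (μ : Fin (ν + 1) → ℂ) (m : Deg ν) : Submodule ℂ V where
  carrier := {v | v ∈ E ∧ ∀ i, ⁅dt (𝔤 := 𝔤) ν Φ c₁ c₂ 0 i (1 : B), v⁆ = (μ i + (m i : ℂ)) • v}
  zero_mem' := ⟨E.zero_mem, by simp⟩
  add_mem' {v w} hv hw := ⟨add_mem hv.1 hw.1, fun i => by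
    rw [lie_add, hv.2, hw.2, smul_add]⟩
  smul_mem' c v hv := ⟨E.smul_mem c hv.1, fun i => by rw [lie_smul, hv.2, smul_comm]⟩

section Graded

variable {E : Submodule ℂ V} {μ : Fin (ν + 1) → ℂ}

local notation "GP" => gradedPiece ν Φ c₁ c₂ B E μ

theorem lie_mem_gradedPiece {y : TauB ν Φ c₁ c₂ B} {n : Deg ν} (hy : ∀ v ∈ E, ⁅y, v⁆ ∈ E)
    (hyd : ∀ i, ⁅DT 0 i (1 : B), y⁆ = ((n i : ℤ) : ℂ) • y) (m : Deg ν) (v : V) (hv : v ∈ GP m) :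
    ⁅y, v⁆ ∈ GP (n + m) := by
  refine ⟨hy v hv.1, fun i => ?_⟩
  rw [leibniz_lie, hyd, hv.2, lie_smul, tauB_smul_lie, ← add_smul, Pi.add_apply, Int.cast_add]
  congr 1
  ring

theorem lie_dt_zero_xt (x : 𝔤) (n : Deg ν) (b : B) (i : Fin (ν + 1)) :
    ⁅DT 0 i (1 : B), XT x n b⁆ = ((n i : ℤ) : ℂ) • XT x n b := by
  rw [lie_dt_xt, zero_add, one_mul]

theorem lie_dt_zero_kt (p : Fin (ν + 1)) (n : Deg ν) (b : B) (i : Fin (ν + 1)) :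
    ⁅DT 0 i (1 : B), KT n p b⁆ = ((n i : ℤ) : ℂ) • KT n p b := by
  rw [lie_dt_kt, zero_add, one_mul, kst_zero_right, ite_self, add_zero]

theorem xt_mem_gradedPiece (hE : IsZeroStable H ν Φ c₁ c₂ B E) {h : 𝔤} (hh : h ∈ H) (n : Deg ν)
    (b : B) (m : Deg ν) (v : V) (hv : v ∈ GP m) : ⁅XT h n b, v⁆ ∈ GP (n + m) :=
  lie_mem_gradedPiece (hE.xt h hh n b) (lie_dt_zero_xt h n b) m v hv

theorem kt_mem_gradedPiece (hE : IsZeroStable H ν Φ c₁ c₂ B E) (p : Fin (ν + 1)) (n : Deg ν)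
    (b : B) (m : Deg ν) (v : V) (hv : v ∈ GP m) : ⁅KT n p b, v⁆ ∈ GP (n + m) :=
  lie_mem_gradedPiece (hE.kt n p b) (lie_dt_zero_kt p n b) m v hv

theorem dt_mem_gradedPiece (hE : IsZeroStable H ν Φ c₁ c₂ B E) (a : Fin (ν + 1)) (n : Deg ν)
    (b : B) (m : Deg ν) (v : V) (hv : v ∈ GP m) : ⁅DT n a b, v⁆ ∈ GP (n + m) :=
  lie_mem_gradedPiece (hE.dt n a b) (fun i => lie_dt_zero_dt i a n b) m v hv

theorem gradedPiece_le (m : Deg ν) : GP m ≤ E := fun _ hv => hv.1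

theorem isZeroStable_iSup_gradedPiece (hE : IsZeroStable H ν Φ c₁ c₂ B E) :
    IsZeroStable H ν Φ c₁ c₂ B (⨆ m, GP m) where
  xt _ hh n b := iSup_mapsTo (T := toEnd ℂ (TauB ν Φ c₁ c₂ B) V _) (xt_mem_gradedPiece hE hh n b)
  kt n p b := iSup_mapsTo (T := toEnd ℂ (TauB ν Φ c₁ c₂ B) V _) (kt_mem_gradedPiece hE p n b)
  dt n a b := iSup_mapsTo (T := toEnd ℂ (TauB ν Φ c₁ c₂ B) V _) (dt_mem_gradedPiece hE a n b)

end Graded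

end Top

/-! ### Representation theory of sl₂ and bounded dimensions of the graded pieces. -/

section Bounded

set_option linter.unusedSectionVars false

open LieAlgebra LieModule

variable {𝔤 : Type*} [LieRing 𝔤] [LieAlgebra ℂ 𝔤] [FiniteDimensional ℂ 𝔤]
  [LieAlgebra.IsSimple ℂ 𝔤] {H : LieSubalgebra ℂ 𝔤} [H.IsCartanSubalgebra]
  {base : (LieAlgebra.IsKilling.rootSystem H).Base}
  {ν : ℕ} {Φ : InvariantForm 𝔤} {c₁ c₂ : ℂ} {B : Type*} [CommRing B] [Algebra ℂ B]
  {V : Type*} [AddCommGroup V] [Module ℂ V] [LieRingModule (TauB ν Φ c₁ c₂ B) V]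
  [LieModule ℂ (TauB ν Φ c₁ c₂ B) V]

local notation "XT" => xt ν Φ c₁ c₂
local notation "KT" => kt (𝔤 := 𝔤) ν Φ c₁ c₂
local notation "KST" => kst (𝔤 := 𝔤) ν Φ c₁ c₂
local notation "WS" => weightSpace H ν Φ c₁ c₂ B V

/-- From `e f^{k+1} v = (k + 1)(c - k) f^k v`, the first vanishing power of `f` forces `c = k`. Thus
the last nonvanishing power depends only on the weight `c`, not on `v`. -/
theorem sl2_primitive {V : Type*} [AddCommGroup V] [Module ℂ V] {h e f : Module.End ℂ V}
    (hef : ∀ v, e (f v) - f (e v) = h v) (hhf : ∀ v, h (f v) - f (h v) = (-2 : ℂ) • f v) {v : V}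
    {c : ℂ} (hv0 : v ≠ 0) (hev : e v = 0) (hhv : h v = c • v) (hn : ∃ n : ℕ, (f ^ n) v = 0) :
    ∃ k : ℕ, c = k ∧ (f ^ k) v ≠ 0 ∧ (f ^ (k + 1)) v = 0 := by
  have h1 : ∀ k : ℕ, h ((f ^ k) v) = (c - 2 * k) • (f ^ k) v := by
    intro k
    induction k with
    | zero => simpa using hhv
    | succ k ih =>
      have := hhf ((f ^ k) v)
      rw [ih, map_smul, sub_eq_iff_eq_add] at this
      rw [pow_succ', Module.End.mul_apply, this, ← add_smul]
      congr 1
      push_cast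
      ring
  have h2 : ∀ k : ℕ, e ((f ^ (k + 1)) v) = ((k + 1) * (c - k)) • (f ^ k) v := by
    intro k
    induction k with
    | zero =>
      have := hef v
      rw [hev, map_zero, sub_zero, hhv] at this
      simpa using this
    | succ k ih =>
      have := hef ((f ^ (k + 1)) v)
      rw [ih, map_smul, h1, sub_eq_iff_eq_add, show f ((f ^ k) v) = (f ^ (k + 1)) v by
        rw [pow_succ', Module.End.mul_apply], ← add_smul] at this
      rw [pow_succ', Module.End.mul_apply, this]
      congr 1
      push_cast
      ring
  obtain ⟨k, hk, hk'⟩ := Nat.exists_not_and_succ_of_not_zero_of_exists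
    (p := fun n => (f ^ n) v = 0) (by simpa using hv0) hn
  refine ⟨k, ?_, hk, hk'⟩
  have := h2 k
  rw [hk', map_zero] at this
  have h3 := (smul_eq_zero.mp this.symm).resolve_right hk
  exact sub_eq_zero.mp ((mul_eq_zero.mp h3).resolve_left (Nat.cast_add_one_ne_zero k))

theorem lie_kst_zero (hzero : ∀ (i : Fin (ν + 1)) (v : V), ⁅KT 0 i (1 : B), v⁆ = 0) (u : Deg ν)
    (v : V) : ⁅KST 0 u (1 : B), v⁆ = 0 := by
  simp [kst, sum_lie, tauB_smul_lie, hzero]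

/-- A vector of `T` is a highest weight vector for the `sl₂`-triples attached to `α + q`. -/
theorem exists_nat_of_mem_topSpace (hfin : IsCfin H ν Φ c₁ c₂ B V)
    (hzero : ∀ (i : Fin (ν + 1)) (v : V), ⁅KT 0 i (1 : B), v⁆ = 0) {α : H.root}
    (hα : base.IsPos α) {e f : 𝔤} (ht : IsSl2Triple ((IsKilling.coroot α.1 : H) : 𝔤) e f)
    (he : e ∈ rootSpace H α.1) (hf : f ∈ rootSpace H (-α.1 : H → ℂ)) (q : Deg ν) {v : V}
    (hv : v ∈ topSpace ν Φ c₁ c₂ B V base) (hv0 : v ≠ 0) {c : ℂ}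
    (hc : ⁅XT ((IsKilling.coroot α.1 : H) : 𝔤) 0 (1 : B), v⁆ = c • v) :
    ∃ k : ℕ, c = k ∧ ((toEnd ℂ (TauB ν Φ c₁ c₂ B) V (XT f (-q) 1)) ^ k) v ≠ 0 ∧
      ((toEnd ℂ (TauB ν Φ c₁ c₂ B) V (XT f (-q) 1)) ^ (k + 1)) v = 0 := by
  refine sl2_primitive (h := toEnd ℂ (TauB ν Φ c₁ c₂ B) V
      (XT ((IsKilling.coroot α.1 : H) : 𝔤) 0 (1 : B)))
    (e := toEnd ℂ (TauB ν Φ c₁ c₂ B) V (XT e q 1)) (fun w => ?_) (fun w => ?_) hv0 ?_ hc ?_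
  · simp only [toEnd_apply_apply]
    -- The central term lies in degree `0` with coefficient `1 ∈ B`, so zero central charge makes `e
    -- ⊗ t^q`, `f ⊗ t^{-q}` an honest sl₂-pair on `V`.
    rw [← lie_lie, lie_xt_xt, add_neg_cancel, ht.lie_e_f, add_lie, tauB_smul_lie, mul_one,
      lie_kst_zero hzero, smul_zero, add_zero]
  · simp only [toEnd_apply_apply]
    rw [← lie_lie, lie_xt_zero_xt, ht.lie_lie_smul_f ℂ, ← neg_smul, xt_smul_left, tauB_smul_lie,
      mul_one]
  · exact hv α hα e he q 1
  · exact hfin.nilpotent (-α.1) (LieSubalgebra.isNonZero_coe_root α).neg f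
      (by rwa [LieModule.Weight.coe_neg]) (-q) 1 v

theorem lie_toEnd_pow {y x : TauB ν Φ c₁ c₂ B} {s c : ℂ} (hyx : ⁅y, x⁆ = s • x) {v : V}
    (hv : ⁅y, v⁆ = c • v) (k : ℕ) : ⁅y, ((toEnd ℂ (TauB ν Φ c₁ c₂ B) V x) ^ k) v⁆ =
      (c + k * s) • ((toEnd ℂ (TauB ν Φ c₁ c₂ B) V x) ^ k) v := by
  induction k with
  | zero => simpa using hv
  | succ k ih =>
    rw [pow_succ', Module.End.mul_apply, toEnd_apply_apply, leibniz_lie, ih, hyx, tauB_smul_lie,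
      lie_smul, ← add_smul]
    congr 1
    push_cast
    ring

/-- The weight `(λ - Nα, 0, μ + r)`. -/
noncomputable def loweredWeight (lam : Module.Dual ℂ H) (μ : Fin (ν + 1) → ℂ) (α : H.root) (N : ℕ)
    (r : Deg ν) : Module.Dual ℂ (Cartan H ν) :=
  (lam - (N : ℂ) • α.1.toLinear).coprod
    (LinearMap.coprod 0 (∑ i, (μ i + (r i : ℂ)) • LinearMap.proj i))

variable {E : Submodule ℂ V}

/-- If `λ(α^∨) = N > 0`, translations by `N` bound the dimensions of the pieces of `E`. -/
theorem IsTop.exists_finrank_le (hE : IsTop base ν Φ c₁ c₂ B E) (hfin : IsCfin H ν Φ c₁ c₂ B V)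
    (hzero : ∀ (i : Fin (ν + 1)) (v : V), ⁅KT 0 i (1 : B), v⁆ = 0) {lam : Module.Dual ℂ H}
    (hlam : ∀ h : H, ∀ v ∈ E, ⁅XT (h : 𝔤) 0 (1 : B), v⁆ = lam h • v) (h0 : lam ≠ 0)
    (μ : Fin (ν + 1) → ℂ) : ∃ n : ℕ, ∀ m, FiniteDimensional ℂ (gradedPiece ν Φ c₁ c₂ B E μ m) ∧
      Module.finrank ℂ (gradedPiece ν Φ c₁ c₂ B E μ m) ≤ n := by
  obtain ⟨α, hα, hne⟩ := exists_isPos_coroot_ne_zero base h0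
  obtain ⟨e, f, ht, he, hf⟩ := exists_sl2_of_root α
  have hsl2 : ∀ q, ∀ v ∈ E, v ≠ 0 → ∃ k : ℕ, lam (IsKilling.coroot α.1) = k ∧
      ((toEnd ℂ (TauB ν Φ c₁ c₂ B) V (XT f (-q) 1)) ^ k) v ≠ 0 ∧
      ((toEnd ℂ (TauB ν Φ c₁ c₂ B) V (XT f (-q) 1)) ^ (k + 1)) v = 0 := fun q v hv hv0 =>
    exists_nat_of_mem_topSpace hfin hzero hα ht he hf q (hE.le_top hv) hv0 (hlam _ v hv)
  obtain ⟨v₀, hv₀, hv₀0⟩ := Submodule.exists_mem_ne_zero_of_ne_bot hE.ne_bot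
  obtain ⟨N, hN, -, -⟩ := hsl2 0 v₀ hv₀ hv₀0
  have hN0 : N ≠ 0 := by
    rintro rfl
    exact hne (by simpa using hN)
  -- Every degree is congruent modulo `N` to one of finitely many residues `r`, so the sum of these
  -- weight multiplicities bounds every piece.
  refine ⟨∑ r : Fin (ν + 1) → Fin N, Module.finrank ℂ
    (WS (loweredWeight lam μ α N fun i => ((r i : ℕ) : ℤ))), fun m => ?_⟩
  set r : Fin (ν + 1) → Fin N := fun i => ⟨(m i % N).toNat, by
    have h1 := Int.emod_nonneg (m i) (Int.natCast_ne_zero.mpr hN0)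
    have h2 := Int.emod_lt_of_pos (m i) (Int.natCast_pos.mpr (Nat.pos_of_ne_zero hN0))
    omega⟩ with hr
  set q : Deg ν := fun i => m i / N with hq
  have hrq : ∀ i, (((r i : ℕ) : ℤ) : ℂ) = (m i : ℂ) - N * (q i : ℂ) := by
    intro i
    have h1 := Int.emod_nonneg (m i) (Int.natCast_ne_zero.mpr hN0)
    have h2 : ((r i : ℕ) : ℤ) = m i - N * q i := by
      simp only [hr, hq]
      rw [Int.toNat_of_nonneg h1, Int.emod_def]
    rw [h2]
    push_cast
    rfl
  -- With `q = ⌊m / N⌋` taken coordinatewise, `F^N` moves degree `m` to its remainder `m - Nq = r`.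
  set F := toEnd ℂ (TauB ν Φ c₁ c₂ B) V (XT f (-q) 1) with hF
  have hmaps : ∀ v ∈ gradedPiece ν Φ c₁ c₂ B E μ m,
      (F ^ N) v ∈ WS (loweredWeight lam μ α N fun i => ((r i : ℕ) : ℤ)) := by
    rintro v ⟨hv, hvd⟩
    refine mem_weightSpace_iff.mpr ⟨fun h => ?_, fun i => ?_, fun i => ?_⟩
    · rw [hF, lie_toEnd_pow (s := -α.1 h) _ (hlam h v hv)]
      · simp [loweredWeight, sub_eq_add_neg]
      · rw [lie_xt_zero_xt, lie_cartan_of_mem_rootSpace h.2 hf, xt_smul_left, mul_one]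
        rfl
    · rw [hzero]
      simp [loweredWeight]
    · rw [hF, lie_toEnd_pow (lie_dt_zero_xt f (-q) 1 i) (hvd i)]
      congr 1
      have : loweredWeight lam μ α N (fun i => ((r i : ℕ) : ℤ)) (0, 0, Pi.single i 1) =
          μ i + (((r i : ℕ) : ℤ) : ℂ) := by
        simp [loweredWeight, Pi.single_apply]
      rw [this, hrq]
      push_cast [Pi.neg_apply]
      ring
  have hinj : Function.Injective ((F ^ N).restrict hmaps) := by
    rw [← LinearMap.ker_eq_bot, LinearMap.ker_eq_bot']
    rintro ⟨v, hv⟩ h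
    have h' : (F ^ N) v = 0 := congrArg Subtype.val h
    by_contra hne'
    obtain ⟨k, hk, hk', -⟩ := hsl2 q v hv.1 (fun h0 => hne' (Subtype.ext h0))
    rw [hN, Nat.cast_inj] at hk
    subst hk
    exact hk' h'
  have := hfin.finite (loweredWeight lam μ α N fun i => ((r i : ℕ) : ℤ))
  refine ⟨FiniteDimensional.of_injective _ hinj,
    (LinearMap.finrank_le_finrank_of_injective hinj).trans ?_⟩
  exact Finset.single_le_sum (f := fun r : Fin (ν + 1) → Fin N => Module.finrank ℂ
    (WS (loweredWeight lam μ α N fun i => ((r i : ℕ) : ℤ)))) (fun _ _ => Nat.zero_le _)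
    (Finset.mem_univ r)

/-- If `𝔥̇` acts trivially on `E`, then `𝔤 ⊗ A ⊗ B` acts trivially on `V`. -/
theorem IsTop.lie_xt_eq_zero (hE : IsTop base ν Φ c₁ c₂ B E)
    (hirr : LieModule.IsIrreducible ℂ (TauB ν Φ c₁ c₂ B) V) (hfin : IsCfin H ν Φ c₁ c₂ B V)
    (hzero : ∀ (i : Fin (ν + 1)) (v : V), ⁅KT 0 i (1 : B), v⁆ = 0)
    (hlam : ∀ h : H, ∀ v ∈ E, ⁅XT (h : 𝔤) 0 (1 : B), v⁆ = 0) (x : 𝔤) (m : Deg ν) (b : B) (v : V) :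
    ⁅XT x m b, v⁆ = 0 := by
  have hneg1 : ∀ α, base.IsPos α → ∀ x ∈ rootSpace H (-α.1 : H → ℂ), ∀ m, ∀ v ∈ E,
      ⁅XT x m (1 : B), v⁆ = 0 := by
    intro α hα x hx m v hv
    obtain ⟨e, f, ht, he, hf⟩ := exists_sl2_of_root α
    obtain ⟨c, rfl⟩ := exists_smul_of_mem_rootSpace α hf ht.f_ne_zero hx
    rw [xt_smul_left, tauB_smul_lie]
    by_cases hv0 : v = 0
    · simp [hv0]
    obtain ⟨k, hk, -, hk'⟩ := exists_nat_of_mem_topSpace hfin hzero hα ht he hf (-m)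
      (hE.le_top hv) hv0 (c := 0) (by rw [hlam _ v hv, zero_smul])
    have : k = 0 := by simpa using hk.symm
    subst this
    rw [neg_neg, zero_add, pow_one, toEnd_apply_apply] at hk'
    rw [hk', smul_zero]
  have hneg : ∀ α, base.IsPos α → ∀ x ∈ rootSpace H (-α.1 : H → ℂ), ∀ m (b : B), ∀ v ∈ E,
      ⁅XT x m b, v⁆ = 0 := by
    intro α hα x hx m b v hv
    -- Coefficients `b` come from derivations: with `ε` the first unit exponent, `x ⊗ t^m ⊗ b =
    -- [t^{m-ε} d₀ ⊗ b, x ⊗ t^ε ⊗ 1]`.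
    have h1 := lie_dt_xt (Φ := Φ) (c₁ := c₁) (c₂ := c₂) 0 x (m - Pi.single 0 1) (Pi.single 0 1) b 1
    rw [Pi.single_eq_same, Int.cast_one, one_smul, sub_add_cancel, mul_one] at h1
    rw [← h1, lie_lie, hneg1 α hα x hx _ v hv, lie_zero,
      hneg1 α hα x hx _ _ (hE.stable.dt _ _ _ v hv), sub_zero]
  have hcar : ∀ h : H, ∀ m (b : B), ∀ v ∈ E, ⁅XT (h : 𝔤) m b, v⁆ = 0 := by
    intro h m b v hv
    let L : H →ₗ[ℂ] V :=
      { toFun := fun h => ⁅XT (h : 𝔤) m b, v⁆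
        map_add' := fun x y => by
          change ⁅XT ((x : 𝔤) + (y : 𝔤)) m b, v⁆ = _
          rw [xt_add_left, add_lie]
        map_smul' := fun c x => by
          change ⁅XT (c • (x : 𝔤)) m b, v⁆ = _
          rw [xt_smul_left, tauB_smul_lie, RingHom.id_apply] }
    have hL : L = 0 := by
      apply base.toCoweightBasis.ext
      intro i
      rw [RootPairing.Base.toCoweightBasis_apply]
      obtain ⟨e, f, ht, he, hf⟩ := exists_sl2_of_root i.1
      have hi := base.isPos_of_mem_support i.2
      change ⁅XT ((IsKilling.coroot i.1.1 : H) : 𝔤) m b, v⁆ = 0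
      -- The element `α^∨ ⊗ t^m ⊗ b` is `[e ⊗ 1, f ⊗ t^m ⊗ b]`, and both factors kill `E`.
      have h1 := lie_xt_zero_xt (Φ := Φ) (c₁ := c₁) (c₂ := c₂) e f m 1 b
      rw [one_mul, ht.lie_e_f] at h1
      rw [← h1, lie_lie, hneg _ hi f hf m b v hv, hE.le_top hv _ hi e he, lie_zero, lie_zero,
        sub_zero]
    exact LinearMap.congr_fun hL h
  let S : Submodule ℂ V :=
    { carrier := {v | ∀ x m (b : B), ⁅XT x m b, v⁆ = 0}
      zero_mem' := by simp
      add_mem' := fun {v w} hv hw x m b => by rw [lie_add, hv, hw, add_zero]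
      smul_mem' := fun c v hv x m b => by rw [lie_smul, hv, smul_zero] }
  have hES : E ≤ S := by
    intro v hv x m b
    induction x using cartan_root_induction base with
    | hadd x y hx hy => rw [xt_add_left, add_lie, hx, hy, add_zero]
    | hH x hx => exact hcar ⟨x, hx⟩ m b v hv
    | hpos α hα x hx => exact hE.le_top hv α hα x hx m b
    | hneg α hα x hx => exact hneg α hα x hx m b v hv
  have hS : S = ⊤ := by
    refine eq_top_of_stable hirr S (ne_bot_of_le_ne_bot hE.ne_bot hES) (fun x m b v hv => ?_)
      (fun p m b v hv x n b' => ?_) (fun a m b v hv x n b' => ?_)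
    · rw [hv]
      exact S.zero_mem
    · rw [leibniz_lie, hv, lie_zero, add_zero, lie_xt_kt, zero_lie]
    · rw [leibniz_lie, hv, lie_zero, add_zero, ← lie_skew, lie_dt_xt, neg_lie, tauB_smul_lie, hv,
        smul_zero, neg_zero]
  exact (hS ▸ Submodule.mem_top : v ∈ S) x m b

end Bounded

/-! ### The center `𝒦 ⊗ B` acts trivially. -/

section Central

set_option linter.unusedSectionVars false

open LieAlgebra LieModule

variable {𝔤 : Type*} [LieRing 𝔤] [LieAlgebra ℂ 𝔤] [FiniteDimensional ℂ 𝔤]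
  [LieAlgebra.IsSimple ℂ 𝔤] {H : LieSubalgebra ℂ 𝔤} [H.IsCartanSubalgebra]
  {base : (LieAlgebra.IsKilling.rootSystem H).Base}
  {ν : ℕ} {Φ : InvariantForm 𝔤} {c₁ c₂ : ℂ} {B : Type*} [CommRing B] [Algebra ℂ B]
  {V : Type*} [AddCommGroup V] [Module ℂ V] [LieRingModule (TauB ν Φ c₁ c₂ B) V]
  [LieModule ℂ (TauB ν Φ c₁ c₂ B) V]

local notation "XT" => xt ν Φ c₁ c₂
local notation "KT" => kt (𝔤 := 𝔤) ν Φ c₁ c₂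
local notation "DT" => dt (𝔤 := 𝔤) ν Φ c₁ c₂

variable {E : Submodule ℂ V} {μ : Fin (ν + 1) → ℂ}

local notation "GP" => gradedPiece ν Φ c₁ c₂ B E μ
local notation "RT" => toEnd ℂ (TauB ν Φ c₁ c₂ B) V

theorem toEnd_pow_eq_zero (hsup : ⨆ m, GP m = E) {N : ℕ}
    (hbd : ∀ m, FiniteDimensional ℂ (GP m) ∧ Module.finrank ℂ (GP m) ≤ N) {q : Deg ν}
    {P Q X : TauB ν Φ c₁ c₂ B} (hP : ∀ m, ∀ v ∈ GP m, ⁅P, v⁆ ∈ GP (-q + m))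
    (hQ : ∀ m, ∀ v ∈ GP m, ⁅Q, v⁆ ∈ GP (q + m)) (hX : ∀ m, ∀ v ∈ GP m, ⁅X, v⁆ ∈ GP (q + m))
    {c : ℂ} (hc : c ≠ 0) (hPQ : ∀ v ∈ E, ⁅⁅P, Q⁆, v⁆ = c • v)
    (hPX : ∀ v ∈ E, ⁅⁅P, X⁆, v⁆ = 0) (hQX : ∀ v ∈ E, ⁅⁅Q, X⁆, v⁆ = 0) :
    ∀ v ∈ E, ((RT X) ^ N) v = 0 := by
  have := fun m => (hbd m).1
  have h := pow_eq_zero_of_heisenberg (E := fun m => GP m) (n := N) (q := q) (P := RT P)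
    (Q := RT Q) (X := RT X) (fun m => (hbd m).2) hP hQ hX hc
  rw [hsup] at h
  exact h (fun v hv => (lie_lie P Q v).symm.trans (hPQ v hv))
    (fun v hv => sub_eq_zero.mp ((lie_lie P X v).symm.trans (hPX v hv)))
    (fun v hv => sub_eq_zero.mp ((lie_lie Q X v).symm.trans (hQX v hv)))

theorem det_eq_zero (hsup : ⨆ m, GP m = E) (hne : E ≠ ⊥) {N : ℕ}
    (hbd : ∀ m, FiniteDimensional ℂ (GP m) ∧ Module.finrank ℂ (GP m) ≤ N) {q : Deg ν}
    {P₁ P₂ Q₁ Q₂ : TauB ν Φ c₁ c₂ B} (hP₁ : ∀ m, ∀ v ∈ GP m, ⁅P₁, v⁆ ∈ GP (-q + m))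
    (hP₂ : ∀ m, ∀ v ∈ GP m, ⁅P₂, v⁆ ∈ GP (-q + m)) (hQ₁ : ∀ m, ∀ v ∈ GP m, ⁅Q₁, v⁆ ∈ GP (q + m))
    (hQ₂ : ∀ m, ∀ v ∈ GP m, ⁅Q₂, v⁆ ∈ GP (q + m)) {c₁₁ c₁₂ c₂₁ c₂₂ : ℂ}
    (h₁₁ : ∀ v ∈ E, ⁅⁅P₁, Q₁⁆, v⁆ = c₁₁ • v) (h₁₂ : ∀ v ∈ E, ⁅⁅P₁, Q₂⁆, v⁆ = c₁₂ • v)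
    (h₂₁ : ∀ v ∈ E, ⁅⁅P₂, Q₁⁆, v⁆ = c₂₁ • v) (h₂₂ : ∀ v ∈ E, ⁅⁅P₂, Q₂⁆, v⁆ = c₂₂ • v)
    (hP : ⁅P₁, P₂⁆ = 0) : c₁₁ * c₂₂ = c₁₂ * c₂₁ := by
  have := fun m => (hbd m).1
  have hE : ∃ m, GP m ≠ ⊥ := by
    by_contra! hcon
    exact hne (by rw [← hsup]; simp [hcon])
  have h := det_eq_zero_of_heisenberg (E := fun m => GP m) (n := N) (q := q) (P₁ := RT P₁)
    (P₂ := RT P₂) (Q₁ := RT Q₁) (Q₂ := RT Q₂) (c₁₁ := c₁₁) (c₁₂ := c₁₂) (c₂₁ := c₂₁) (c₂₂ := c₂₂)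
    (fun m => (hbd m).2) hE hP₁ hP₂ hQ₁ hQ₂
  rw [hsup] at h
  exact h (fun v hv => (lie_lie _ _ v).symm.trans (h₁₁ v hv))
    (fun v hv => (lie_lie _ _ v).symm.trans (h₁₂ v hv))
    (fun v hv => (lie_lie _ _ v).symm.trans (h₂₁ v hv))
    (fun v hv => (lie_lie _ _ v).symm.trans (h₂₂ v hv))
    (fun v _ => sub_eq_zero.mp ((lie_lie P₁ P₂ v).symm.trans (by rw [hP, zero_lie])))

/-- If `X` is nilpotent on `E`, some nonzero vector of `E` is killed by all `[δ, X]` that commute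
with `X`. -/
theorem exists_ne_zero_forall_lie_eq_zero (hne : E ≠ ⊥) {X : TauB ν Φ c₁ c₂ B}
    (hXE : ∀ v ∈ E, ⁅X, v⁆ ∈ E) {N : ℕ} (hX : ∀ v ∈ E, ((RT X) ^ N) v = 0) :
    ∃ v ∈ E, v ≠ 0 ∧ ∀ δ : TauB ν Φ c₁ c₂ B, (∀ w ∈ E, ⁅δ, w⁆ ∈ E) →
      (∀ w ∈ E, ⁅X, ⁅⁅δ, X⁆, w⁆⁆ = ⁅⁅δ, X⁆, ⁅X, w⁆⁆) → ⁅⁅δ, X⁆, v⁆ = 0 := by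
  have hXk : ∀ k, ∀ v ∈ E, ((RT X) ^ k) v ∈ E := by
    intro k v hv
    induction k with
    | zero => simpa using hv
    | succ k ih => rw [pow_succ', Module.End.mul_apply]; exact hXE _ ih
  obtain ⟨v₀, hv₀, hv₀0⟩ := Submodule.exists_mem_ne_zero_of_ne_bot hne
  -- Take the last power `X^k` that is nonzero on `E`; it does not depend on `δ`, so one vector `X^k
  -- w` serves every `δ`.
  obtain ⟨k, hk, hk'⟩ := Nat.exists_not_and_succ_of_not_zero_of_exists
    (p := fun n => ∀ v ∈ E, ((RT X) ^ n) v = 0) (fun h => hv₀0 (by simpa using h v₀ hv₀)) ⟨N, hX⟩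
  push Not at hk
  obtain ⟨w, hw, hw0⟩ := hk
  refine ⟨((RT X) ^ k) w, hXk k w hw, hw0, fun δ hδ hcomm => ?_⟩
  have hp : ∀ j u, ⁅X, ((RT X) ^ j) u⁆ = ((RT X) ^ (j + 1)) u := fun j u => by
    rw [pow_succ', Module.End.mul_apply, toEnd_apply_apply]
  -- Leibniz rule for `X^{j+1}`; at `j = k` both powers `X^{k+1}` vanish and only `(k + 1)[δ, X] X^k
  -- w` remains.
  have key : ∀ j, ⁅δ, ((RT X) ^ (j + 1)) w⁆ =
      ((RT X) ^ (j + 1)) ⁅δ, w⁆ + ((j + 1 : ℕ) : ℂ) • ⁅⁅δ, X⁆, ((RT X) ^ j) w⁆ := by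
    intro j
    induction j with
    | zero =>
      simp only [zero_add, pow_one, toEnd_apply_apply, pow_zero, Module.End.one_apply,
        Nat.cast_one, one_smul]
      rw [leibniz_lie, add_comm]
    | succ j ih =>
      rw [← hp (j + 1) w, leibniz_lie, ih, lie_add, lie_smul, hcomm _ (hXk j w hw), hp, hp]
      push_cast
      module
  have h1 := key k
  rw [hk' w hw, lie_zero, hk' _ (hδ w hw), zero_add] at h1
  exact (smul_eq_zero.mp h1.symm).resolve_left (Nat.cast_ne_zero.mpr k.succ_ne_zero)

theorem exists_apply_ne_zero {lam : Module.Dual ℂ H} (h0 : lam ≠ 0) : ∃ h : H, lam h ≠ 0 := by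
  by_contra! hcon
  exact h0 (LinearMap.ext hcon)

/-- For every `p`, some nonzero vector of `E` is killed by all `t^n kₚ ⊗ b`. -/
theorem IsTop.exists_ne_zero_lie_kt_eq_zero (hE : IsTop base ν Φ c₁ c₂ B E) (hν : 1 ≤ ν)
    (hzero : ∀ (i : Fin (ν + 1)) (v : V), ⁅KT 0 i (1 : B), v⁆ = 0)
    (hsup : ⨆ m, GP m = E) {N : ℕ}
    (hbd : ∀ m, FiniteDimensional ℂ (GP m) ∧ Module.finrank ℂ (GP m) ≤ N)
    {lam : Module.Dual ℂ H} (hlam : ∀ h : H, ∀ v ∈ E, ⁅XT (h : 𝔤) 0 (1 : B), v⁆ = lam h • v)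
    (h0 : lam ≠ 0) (p : Fin (ν + 1)) :
    ∃ v ∈ E, v ≠ 0 ∧ ∀ n (b : B), ⁅KT n p b, v⁆ = 0 := by
  obtain ⟨h, hh⟩ := exists_apply_ne_zero h0
  have : Nontrivial (Fin (ν + 1)) := Fin.nontrivial_iff_two_le.mpr (by omega)
  -- An index `a ≠ p` kills the `δ_{ap}` term, and the unit exponent `q` at `a` makes `[t^n d_a ⊗ b,
  -- t^q k_p]` exactly `t^{n+q} k_p ⊗ b`.
  obtain ⟨a, ha⟩ := exists_ne p
  set q : Deg ν := Pi.single a 1 with hq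
  have hqa : ((q a : ℤ) : ℂ) = 1 := by simp [hq]
  have hder : ∀ n (b : B), ⁅DT n a b, KT q p 1⁆ = KT (n + q) p b := fun n b => by
    rw [lie_dt_kt, if_neg ha, hqa, one_smul, add_zero, mul_one]
  have hnil := toEnd_pow_eq_zero hsup hbd (q := q) (P := DT (-q) a 1) (Q := XT h q 1)
    (X := KT q p 1) (c := lam h) (dt_mem_gradedPiece hE.stable _ _ _)
    (xt_mem_gradedPiece hE.stable h.2 _ _) (kt_mem_gradedPiece hE.stable _ _ _) hh
    (fun v hv => by rw [lie_dt_xt, hqa, one_smul, neg_add_cancel, mul_one, hlam h v hv])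
    -- `[t^{-q} d_a, t^q k_p] = k_p` acts by zero: this is where zero central charge gives the
    -- commutation.
    (fun v hv => by rw [hder, neg_add_cancel, hzero])
    (fun v hv => by rw [lie_xt_kt, zero_lie])
  obtain ⟨v, hv, hv0, hvk⟩ := exists_ne_zero_forall_lie_eq_zero hE.ne_bot
    (hE.stable.kt q p 1) hnil
  refine ⟨v, hv, hv0, fun n b => ?_⟩
  have h1 := hvk (DT (n - q) a b) (hE.stable.dt _ _ _) (fun w _ => by
    rw [hder, ← sub_eq_zero, ← lie_lie, lie_kt_kt, zero_lie])
  rwa [hder, sub_add_cancel] at h1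

variable (ν Φ c₁ c₂ B V) in
/-- The vectors killed by all products of `M` elements `t^n kₚ ⊗ b`. -/
def centralFiltration (p : Fin (ν + 1)) : ℕ → Submodule ℂ V
  | 0 => ⊥
  | M + 1 =>
    { carrier := {v | ∀ n (b : B), ⁅kt (𝔤 := 𝔤) ν Φ c₁ c₂ n p b, v⁆ ∈ centralFiltration p M}
      zero_mem' := fun n b => by rw [lie_zero]; exact zero_mem _
      add_mem' := fun hv hw n b => by rw [lie_add]; exact add_mem (hv n b) (hw n b)
      smul_mem' := fun c v hv n b => by rw [lie_smul]; exact Submodule.smul_mem _ c (hv n b) }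

local notation "CF" => centralFiltration ν Φ c₁ c₂ B V

theorem centralFiltration_stable (p : Fin (ν + 1)) {y : TauB ν Φ c₁ c₂ B}
    (hy : ∀ n (b : B), ⁅KT n p b, y⁆ = 0) (M : ℕ) : ∀ v ∈ CF p M, ⁅y, v⁆ ∈ CF p M := by
  induction M with
  | zero =>
    intro v hv
    have : v = 0 := hv
    rw [this, lie_zero]
    exact zero_mem _
  | succ M ih =>
    intro v hv n b
    rw [leibniz_lie, hy, zero_lie, zero_add]
    exact ih _ (hv n b)

theorem centralFiltration_mono (p : Fin (ν + 1)) : Monotone (CF p) := by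
  refine monotone_nat_of_le_succ fun M => ?_
  intro v hv n b
  exact centralFiltration_stable p (fun n' b' => lie_kt_kt _ _ _ _ _ _) M v hv

/-- One level is lost because, for `a = p`, the commutator involves `k_q` with `q ≠ p`, which is
only known to preserve the filtration. -/
theorem lie_dt_mem_centralFiltration (p : Fin (ν + 1)) (m : Deg ν) (a : Fin (ν + 1)) (b : B)
    (M : ℕ) : ∀ v ∈ CF p M, ⁅DT m a b, v⁆ ∈ CF p (M + 1) := by
  induction M with
  | zero =>
    intro v hv
    have : v = 0 := hv
    rw [this, lie_zero]
    exact zero_mem _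
  | succ M ih =>
    intro v hv n b'
    have hk : ∀ n q (b : B), ⁅KT n q b, v⁆ ∈ CF p (M + 1) := fun n q b =>
      centralFiltration_stable p (fun n' b' => lie_kt_kt _ _ _ _ _ _) _ v hv
    rw [leibniz_lie, ← lie_skew, neg_lie, lie_dt_kt, add_lie, tauB_smul_lie]
    refine add_mem (neg_mem (add_mem (Submodule.smul_mem _ _ (hk _ _ _)) ?_)) (ih _ (hv n b'))
    split_ifs
    · exact lie_kst_mem hk _ _ _
    · rw [zero_lie]
      exact zero_mem _

/-- The union of the filtration is a submodule containing `v₀`, so one annihilated vector makes the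
whole family locally nilpotent on `V`. -/
theorem exists_mem_centralFiltration (hirr : LieModule.IsIrreducible ℂ (TauB ν Φ c₁ c₂ B) V)
    {p : Fin (ν + 1)} {v₀ : V} (hv₀ : v₀ ≠ 0) (hk : ∀ n (b : B), ⁅KT n p b, v₀⁆ = 0) (v : V) :
    ∃ M, v ∈ CF p M := by
  have hdir : Directed (· ≤ ·) (CF p) := (centralFiltration_mono p).directed_le
  have h1 : (⨆ M, CF p M) = ⊤ := by
    refine eq_top_of_stable hirr _ (fun h => hv₀ ?_) (fun x m b v hv => ?_) (fun m q b v hv => ?_)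
      (fun m a b v hv => ?_)
    · have : v₀ ∈ ⨆ M, CF p M := Submodule.mem_iSup_of_mem 1 fun n b => by
        rw [hk]
        exact zero_mem _
      rw [h] at this
      simpa using this
    all_goals
      obtain ⟨M, hM⟩ := (Submodule.mem_iSup_of_directed _ hdir).mp hv
    · exact Submodule.mem_iSup_of_mem M (centralFiltration_stable p
        (fun n b' => by rw [← lie_skew, lie_xt_kt, neg_zero]) M v hM)
    · exact Submodule.mem_iSup_of_mem M (centralFiltration_stable p
        (fun n b' => lie_kt_kt _ _ _ _ _ _) M v hM)
    · exact Submodule.mem_iSup_of_mem (M + 1) (lie_dt_mem_centralFiltration p m a b M v hM)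
  exact (Submodule.mem_iSup_of_directed _ hdir).mp (h1 ▸ Submodule.mem_top)

/-- Operators `t^n k_p ⊗ b` are applied inside `S` until the last nonzero vector is reached. -/
theorem exists_ne_zero_of_mem_centralFiltration {p : Fin (ν + 1)} {S : Submodule ℂ V}
    (hS : ∀ n (b : B), ∀ v ∈ S, ⁅KT n p b, v⁆ ∈ S) (M : ℕ) : ∀ v ∈ S, v ≠ 0 → v ∈ CF p M →
      ∃ w ∈ S, w ≠ 0 ∧ ∀ n (b : B), ⁅KT n p b, w⁆ = 0 := by
  induction M with
  | zero => exact fun v _ hv0 hv => absurd hv hv0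
  | succ M ih =>
    intro v hvS hv0 hv
    by_cases h : ∀ n (b : B), ⁅KT n p b, v⁆ = 0
    · exact ⟨v, hvS, hv0, h⟩
    · push Not at h
      obtain ⟨n, b, h⟩ := h
      exact ih _ (hS n b v hvS) h (hv n b)

/-- `𝒦 ⊗ B` acts trivially on `V` as soon as each family `t^n kₚ ⊗ b` kills a nonzero vector. -/
theorem lie_kt_eq_zero (hirr : LieModule.IsIrreducible ℂ (TauB ν Φ c₁ c₂ B) V)
    (hex : ∀ p, ∃ v : V, v ≠ 0 ∧ ∀ n (b : B), ⁅KT n p b, v⁆ = 0) (n : Deg ν) (p : Fin (ν + 1))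
    (b : B) (v : V) : ⁅KT n p b, v⁆ = 0 := by
  -- A common annihilated vector for all `p` is needed: bracketing `t^n k_p` with `t^m d_p` involves
  -- every `k_q`, so the kernel of a single family need not be a submodule.
  have key : ∀ s : Finset (Fin (ν + 1)),
      ∃ v : V, v ≠ 0 ∧ ∀ p ∈ s, ∀ n (b : B), ⁅KT n p b, v⁆ = 0 := by
    intro s
    induction s using Finset.induction_on with
    | empty =>
      obtain ⟨v, hv, -⟩ := hex 0
      exact ⟨v, hv, by simp⟩
    | insert p s _ ih =>
      obtain ⟨v, hv0, hv⟩ := ih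
      obtain ⟨v₀, hv₀, hk⟩ := hex p
      obtain ⟨M, hM⟩ := exists_mem_centralFiltration hirr hv₀ hk v
      let S : Submodule ℂ V :=
        { carrier := {v | ∀ p ∈ s, ∀ n (b : B), ⁅KT n p b, v⁆ = 0}
          zero_mem' := by simp
          add_mem' := fun {v w} hv hw p hp n b => by
            rw [lie_add, hv p hp, hw p hp, add_zero]
          smul_mem' := fun c v hv p hp n b => by rw [lie_smul, hv p hp, smul_zero] }
      obtain ⟨w, hwS, hw0, hw⟩ := exists_ne_zero_of_mem_centralFiltration (p := p) (S := S)
        (fun n b v hv q hq n' b' => by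
          rw [leibniz_lie, lie_kt_kt, zero_lie, hv q hq, lie_zero, add_zero]) M v hv hv0 hM
      refine ⟨w, hw0, fun q hq => ?_⟩
      rcases Finset.mem_insert.mp hq with rfl | hq
      · exact hw
      · exact hwS q hq
  obtain ⟨v₀, hv₀, hk⟩ := key Finset.univ
  let S : Submodule ℂ V :=
    { carrier := {v | ∀ n p (b : B), ⁅KT n p b, v⁆ = 0}
      zero_mem' := by simp
      add_mem' := fun {v w} hv hw n p b => by rw [lie_add, hv, hw, add_zero]
      smul_mem' := fun c v hv n p b => by rw [lie_smul, hv, smul_zero] }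
  have hS : S = ⊤ := by
    refine eq_top_of_stable hirr S (fun h => hv₀ ?_) (fun x m b v hv n p b' => ?_)
      (fun m q b v hv n p b' => ?_) (fun m a b v hv n p b' => ?_)
    · have : v₀ ∈ S := fun n p b => hk p (Finset.mem_univ p) n b
      rw [h] at this
      simpa using this
    · rw [leibniz_lie, hv, lie_zero, add_zero, ← lie_skew, lie_xt_kt, neg_zero, zero_lie]
    · rw [leibniz_lie, hv, lie_zero, add_zero, lie_kt_kt, zero_lie]
    · rw [leibniz_lie, hv, lie_zero, add_zero, ← lie_skew, neg_lie, neg_eq_zero, lie_dt_kt,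
        add_lie, tauB_smul_lie, hv, smul_zero, zero_add]
      split_ifs
      · simp [kst, sum_lie, tauB_smul_lie, hv _ _ _]
      · rw [zero_lie]
  exact (hS ▸ Submodule.mem_top : v ∈ S) n p b

end Central

/-! ### The character `ψ` and the vanishing of `𝔤 ⊗ A ⊗ ker ψ`. -/

section Character

set_option linter.unusedSectionVars false

open LieAlgebra LieModule

variable {𝔤 : Type*} [LieRing 𝔤] [LieAlgebra ℂ 𝔤] [FiniteDimensional ℂ 𝔤]
  [LieAlgebra.IsSimple ℂ 𝔤] {H : LieSubalgebra ℂ 𝔤} [H.IsCartanSubalgebra]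
  {base : (LieAlgebra.IsKilling.rootSystem H).Base}
  {ν : ℕ} {Φ : InvariantForm 𝔤} {c₁ c₂ : ℂ} {B : Type*} [CommRing B] [Algebra ℂ B]
  {V : Type*} [AddCommGroup V] [Module ℂ V] [LieRingModule (TauB ν Φ c₁ c₂ B) V]
  [LieModule ℂ (TauB ν Φ c₁ c₂ B) V]

local notation "XT" => xt ν Φ c₁ c₂
local notation "KT" => kt (𝔤 := 𝔤) ν Φ c₁ c₂
local notation "DT" => dt (𝔤 := 𝔤) ν Φ c₁ c₂
local notation "KST" => kst (𝔤 := 𝔤) ν Φ c₁ c₂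

variable {E : Submodule ℂ V} {μ : Fin (ν + 1) → ℂ}

local notation "GP" => gradedPiece ν Φ c₁ c₂ B E μ

/-- The scalars by which `h ⊗ b` acts on `E` are `ψ(b) λ(h)` for a homomorphism `ψ`. -/
theorem IsTop.exists_character (hE : IsTop base ν Φ c₁ c₂ B E) (hfin : IsCfin H ν Φ c₁ c₂ B V)
    (hsup : ⨆ m, GP m = E) {N : ℕ}
    (hbd : ∀ m, FiniteDimensional ℂ (GP m) ∧ Module.finrank ℂ (GP m) ≤ N)
    {lam : Module.Dual ℂ H} (hlam : ∀ h : H, ∀ v ∈ E, ⁅XT (h : 𝔤) 0 (1 : B), v⁆ = lam h • v)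
    (h0 : lam ≠ 0) : ∃ ψ : B →ₐ[ℂ] ℂ, ∀ h : H, ∀ b, ∀ v ∈ E,
      ⁅XT (h : 𝔤) 0 b, v⁆ = (ψ b * lam h) • v := by
  obtain ⟨h₀, hh₀⟩ := exists_apply_ne_zero h0
  choose χ hχ using fun (h : H) (b : B) => hE.exists_scalar_xt hfin h.2 b
  obtain ⟨v₀, hv₀, hv₀0⟩ := Submodule.exists_mem_ne_zero_of_ne_bot hE.ne_bot
  have huniq : ∀ (h : H) (b : B) (c : ℂ), ⁅XT (h : 𝔤) 0 b, v₀⁆ = c • v₀ → χ h b = c :=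
    fun h b c hc => smul_left_injective ℂ hv₀0 ((hχ h b v₀ hv₀).symm.trans hc)
  have hone : ∀ h, χ h 1 = lam h := fun h => huniq h 1 _ (hlam h v₀ hv₀)
  set q : Deg ν := Pi.single 0 1 with hq
  have hbr : ∀ (h : H) (b b' : B), ∀ v ∈ E,
      ⁅⁅DT (-q) 0 b, XT (h : 𝔤) q b'⁆, v⁆ = χ h (b * b') • v := by
    intro h b b' v hv
    rw [lie_dt_xt, hq, Pi.single_eq_same, Int.cast_one, one_smul, neg_add_cancel, hχ h _ v hv]
  -- The determinant for `t^{-q} d₀ ⊗ 1`, `t^{-q} d₀ ⊗ b` against `h₀ ⊗ t^q ⊗ 1`, `h ⊗ t^q ⊗ b'`.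
  -- Taking `h = h₀` gives multiplicativity of `χ(h₀, ·)/λ(h₀)`; taking `b' = 1` gives independence
  -- of `h`.
  have hdet : ∀ (h : H) (b b' : B), lam h₀ * χ h (b * b') = χ h b' * χ h₀ b := by
    intro h b b'
    have := det_eq_zero hsup hE.ne_bot hbd (q := q) (P₁ := DT (-q) 0 1) (P₂ := DT (-q) 0 b)
      (Q₁ := XT (h₀ : 𝔤) q 1) (Q₂ := XT (h : 𝔤) q b')
      (dt_mem_gradedPiece hE.stable _ _ _) (dt_mem_gradedPiece hE.stable _ _ _)
      (xt_mem_gradedPiece hE.stable h₀.2 _ _) (xt_mem_gradedPiece hE.stable h.2 _ _)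
      (hbr h₀ 1 1) (hbr h 1 b') (hbr h₀ b 1) (hbr h b b') (lie_dt_dt_self _ _ _ _)
    rwa [mul_one, one_mul, mul_one, hone] at this
  let ψ' : B →ₗ[ℂ] ℂ :=
    { toFun := fun b => (lam h₀)⁻¹ * χ h₀ b
      map_add' := fun b b' => by
        rw [huniq h₀ (b + b') (χ h₀ b + χ h₀ b') (by
          rw [xt_add_right, add_lie, hχ h₀ b v₀ hv₀, hχ h₀ b' v₀ hv₀, add_smul]), mul_add]
      map_smul' := fun c b => by
        rw [huniq h₀ (c • b) (c * χ h₀ b) (by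
          rw [xt_smul_right, tauB_smul_lie, hχ h₀ b v₀ hv₀, smul_smul]), RingHom.id_apply,
          smul_eq_mul, mul_left_comm] }
  have hψ' : ∀ b, ψ' b = (lam h₀)⁻¹ * χ h₀ b := fun b => rfl
  refine ⟨AlgHom.ofLinearMap ψ' ?_ fun b b' => ?_, fun h b v hv => ?_⟩
  · rw [hψ', hone, inv_mul_cancel₀ hh₀]
  · rw [hψ', hψ', hψ']
    have := hdet h₀ b b'
    field_simp
    linear_combination this
  · rw [hχ h b v hv, AlgHom.ofLinearMap_apply, hψ']
    congr 1
    have := hdet h b 1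
    rw [mul_one, hone] at this
    field_simp
    linear_combination this

variable {ψ : B →ₐ[ℂ] ℂ}

/-- `𝔥̇ ⊗ A ⊗ ker ψ` acts trivially on `E`. -/
theorem IsTop.lie_cartan_eq_zero (hE : IsTop base ν Φ c₁ c₂ B E)
    (hK : ∀ n p (b : B) (v : V), ⁅KT n p b, v⁆ = 0)
    (hsup : ⨆ m, GP m = E) {N : ℕ}
    (hbd : ∀ m, FiniteDimensional ℂ (GP m) ∧ Module.finrank ℂ (GP m) ≤ N)
    {lam : Module.Dual ℂ H} (hlam : ∀ h : H, ∀ v ∈ E, ⁅XT (h : 𝔤) 0 (1 : B), v⁆ = lam h • v)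
    (h0 : lam ≠ 0)
    (hψ : ∀ h : H, ∀ b, ∀ v ∈ E, ⁅XT (h : 𝔤) 0 b, v⁆ = (ψ b * lam h) • v)
    {h : 𝔤} (hh : h ∈ H) (n : Deg ν) {j : B} (hj : ψ j = 0) : ∀ v ∈ E, ⁅XT h n j, v⁆ = 0 := by
  obtain ⟨h₀, hh₀⟩ := exists_apply_ne_zero h0
  have hkst : ∀ m u (b : B) (v : V), ⁅KST m u b, v⁆ = 0 := fun m u b v => by
    simp [kst, sum_lie, tauB_smul_lie, hK]
  have hcomm : ∀ h ∈ H, ∀ h' ∈ H, ∀ m m' (b b' : B) (v : V),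
      ⁅⁅XT h m b, XT h' m' b'⁆, v⁆ = 0 := fun h hh h' hh' m m' b b' v => by
    rw [lie_xt_xt, lie_cartan_cartan hh hh', xt_zero_left, zero_add, tauB_smul_lie, hkst,
      smul_zero]
  set q : Deg ν := Pi.single 0 1 with hq
  have hder : ∀ n (h : 𝔤) (b b' : B), ⁅DT n 0 b, XT h q b'⁆ = XT h (n + q) (b * b') :=
    fun n h b b' => by rw [lie_dt_xt, hq, Pi.single_eq_same, Int.cast_one, one_smul]
  -- `h ⊗ t^q ⊗ j` commutes with the pair on `E`: with `P` because `h ⊗ j` acts by `ψ(j) λ(h) = 0`,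
  -- with `Q` because `𝒦 ⊗ B` acts trivially.
  have hnil := toEnd_pow_eq_zero hsup hbd (q := q) (P := DT (-q) 0 1) (Q := XT h₀ q 1)
    (X := XT h q j) (c := lam h₀) (dt_mem_gradedPiece hE.stable _ _ _)
    (xt_mem_gradedPiece hE.stable h₀.2 _ _) (xt_mem_gradedPiece hE.stable hh _ _) hh₀
    (fun v hv => by rw [hder, neg_add_cancel, mul_one, hlam h₀ v hv])
    (fun v hv => by
      rw [hder, neg_add_cancel, one_mul, hψ ⟨h, hh⟩ j v hv, hj, zero_mul, zero_smul])
    (fun v _ => hcomm _ h₀.2 _ hh _ _ _ _ v)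
  obtain ⟨w, hw, hw0, hwk⟩ := exists_ne_zero_forall_lie_eq_zero hE.ne_bot
    (hE.stable.xt h hh q j) hnil
  have hwk' : ∀ n (b : B), ⁅XT h n (b * j), w⁆ = 0 := by
    intro n b
    have h1 := hwk (DT (n - q) 0 b) (hE.stable.dt _ _ _) (fun w _ => by
      rw [hder, ← sub_eq_zero, ← lie_lie, hcomm _ hh _ hh])
    rwa [hder, sub_add_cancel] at h1
  let S : Submodule ℂ V :=
    { carrier := {v | ∀ n (b : B), ⁅XT h n (b * j), v⁆ = 0}
      zero_mem' := by simp
      add_mem' := fun {v w} hv hw n b => by rw [lie_add, hv, hw, add_zero]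
      smul_mem' := fun c v hv n b => by rw [lie_smul, hv, smul_zero] }
  have hS : IsZeroStable H ν Φ c₁ c₂ B S :=
    { xt := fun h' hh' m b v hv n b' => by
        rw [leibniz_lie, hv, lie_zero, add_zero, hcomm _ hh _ hh']
      kt := fun m p b v hv n b' => by
        rw [hK, lie_zero]
      dt := fun m a b v hv n b' => by
        rw [leibniz_lie, hv, lie_zero, add_zero, ← lie_skew, neg_lie, lie_dt_xt, tauB_smul_lie,
          ← mul_assoc, hv, smul_zero, neg_zero] }
  have hES : E ≤ S := hE.irred S hS fun hbot => hw0 (by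
    have : w ∈ S ⊓ E := ⟨hwk', hw⟩
    rw [hbot] at this
    simpa using this)
  intro v hv
  simpa using hES hv n 1

/-- If `𝔥̇ ⊗ A ⊗ ker ψ` acts trivially on `E`, then `𝔤 ⊗ A ⊗ ker ψ` acts trivially on `V`. -/
theorem IsTop.lie_xt_ker_eq_zero (hE : IsTop base ν Φ c₁ c₂ B E)
    (hirr : LieModule.IsIrreducible ℂ (TauB ν Φ c₁ c₂ B) V)
    (hK : ∀ n p (b : B) (v : V), ⁅KT n p b, v⁆ = 0)
    (hH : ∀ h ∈ H, ∀ n (j : B), ψ j = 0 → ∀ v ∈ E, ⁅XT h n j, v⁆ = 0)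
    (x : 𝔤) (m : Deg ν) {j : B} (hj : ψ j = 0) (v : V) : ⁅XT x m j, v⁆ = 0 := by
  have hkst : ∀ m u (b : B) (v : V), ⁅KST m u b, v⁆ = 0 := fun m u b v => by
    simp [kst, sum_lie, tauB_smul_lie, hK]
  have hbr : ∀ (x y : 𝔤) m n (b b' : B) (v : V), ⁅XT x m b, ⁅XT y n b', v⁆⁆ =
      ⁅XT ⁅x, y⁆ (m + n) (b * b'), v⁆ + ⁅XT y n b', ⁅XT x m b, v⁆⁆ := fun x y m n b b' v => by
    rw [leibniz_lie, lie_xt_xt, add_lie, tauB_smul_lie, hkst, smul_zero, add_zero]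
  have hmul : ∀ (b : B) {j : B}, ψ j = 0 → ψ (b * j) = 0 := fun b j hj => by
    rw [map_mul, hj, mul_zero]
  have hneg : ∀ k : ℕ, ∀ α : H.root, base.height α = k → base.IsPos α →
      ∀ x ∈ rootSpace H (-α.1 : H → ℂ), ∀ m (j : B), ψ j = 0 → ∀ v ∈ E, ⁅XT x m j, v⁆ = 0 := by
    obtain ⟨ρ, hρ⟩ := exists_height_element base
    intro k
    induction k using Nat.strong_induction_on with
    | _ k ih =>
      intro α hk hα x hx m j hj v hv
      -- It suffices that the lowered vector lies in `T`. Bracketing with `𝔤_β` leaves a coefficient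
      -- in the ideal `ker ψ` and a Cartan element, a positive root vector, or a negative one of
      -- smaller height.
      refine hE.lower α hα x hx m j v hv fun β hβ y hy n b => ?_
      rw [hbr, hE.le_top hv β hβ y hy, lie_zero, add_zero]
      rcases rootSpace_cases base (lie_mem_rootSpace_sub hy hx) with h | h | h | h
      · rw [h, xt_zero_left, zero_lie]
      · exact hH _ h.1 _ _ (hmul b hj) v hv
      · obtain ⟨γ, hγ, -, h⟩ := h
        exact hE.le_top hv γ hγ _ h _ _
      · obtain ⟨γ, hγ, hγ', h⟩ := h
        -- Evaluating `-γ = β - α` at `ρ^∨` turns the relation between roots into one between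
        -- heights.
        have h1 : ((base.height γ : ℤ) : ℂ) = ((base.height α - base.height β : ℤ) : ℂ) := by
          have := congrFun hγ' ρ
          simp only [Pi.sub_apply, Pi.neg_apply, hρ] at this
          push_cast
          linear_combination this
        have h2 := Int.cast_injective h1
        have hβ' : 0 < base.height β := hβ
        have hγ0 : 0 < base.height γ := hγ
        exact ih (base.height γ).toNat (by omega) γ (by omega) hγ _ h _ _ (hmul b hj) v hv
  let S : Submodule ℂ V :=
    { carrier := {v | ∀ x m (j : B), ψ j = 0 → ⁅XT x m j, v⁆ = 0}
      zero_mem' := by simp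
      add_mem' := fun {v w} hv hw x m j hj => by
        rw [lie_add, hv x m j hj, hw x m j hj, add_zero]
      smul_mem' := fun c v hv x m j hj => by rw [lie_smul, hv x m j hj, smul_zero] }
  have hES : E ≤ S := by
    intro v hv x m j hj
    induction x using cartan_root_induction base with
    | hadd x y hx hy => rw [xt_add_left, add_lie, hx, hy, add_zero]
    | hH x hx => exact hH x hx m j hj v hv
    | hpos α hα x hx => exact hE.le_top hv α hα x hx m j
    | hneg α hα x hx =>
      have hα' : 0 < base.height α := hα
      exact hneg (base.height α).toNat α (by omega) hα x hx m j hj v hv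
  have hS : S = ⊤ := by
    refine eq_top_of_stable hirr S (ne_bot_of_le_ne_bot hE.ne_bot hES)
      (fun x m b v hv y n j hj => ?_) (fun p m b v hv y n j hj => ?_)
      (fun a m b v hv y n j hj => ?_)
    · rw [hbr, hv y n j hj, lie_zero, add_zero, mul_comm, hv _ _ _ (hmul b hj)]
    · rw [hK, lie_zero]
    · rw [leibniz_lie, hv y n j hj, lie_zero, add_zero, ← lie_skew, lie_dt_xt, neg_lie,
        tauB_smul_lie, hv _ _ _ (hmul b hj), smul_zero, neg_zero]
  exact (hS ▸ Submodule.mem_top : v ∈ S) x m j hj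

/-- Nullstellensatz: the residue field at a maximal ideal is finite over the algebraically closed
field `ℂ`, hence equal to it. -/
theorem exists_algHom (B : Type*) [CommRing B] [Nontrivial B] [Algebra ℂ B]
    [Algebra.FiniteType ℂ B] : Nonempty (B →ₐ[ℂ] ℂ) := by
  obtain ⟨M, hM⟩ := Ideal.exists_maximal B
  let : Field (B ⧸ M) := Ideal.Quotient.field M
  have : Module.Finite ℂ (B ⧸ M) := finite_of_finite_type_of_isJacobsonRing ℂ (B ⧸ M)
  let e : ℂ ≃ₐ[ℂ] (B ⧸ M) := AlgEquiv.ofBijective (Algebra.ofId ℂ (B ⧸ M))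
    IsAlgClosed.algebraMap_bijective_of_isIntegral
  exact ⟨(e.symm : (B ⧸ M) →ₐ[ℂ] ℂ).comp (Ideal.Quotient.mkₐ ℂ M)⟩

end Character

end FullToroidal

/-! ### Assembly of the theorem. -/

open FullToroidal in
theorem theorem5p9
    {𝔤 : Type*} [LieRing 𝔤] [LieAlgebra ℂ 𝔤] [FiniteDimensional ℂ 𝔤] [LieAlgebra.IsSimple ℂ 𝔤]
    (H : LieSubalgebra ℂ 𝔤) [H.IsCartanSubalgebra]
    (base : (LieAlgebra.IsKilling.rootSystem H).Base)
    (ν : ℕ) (hν : 1 ≤ ν) (Φ : FullToroidal.InvariantForm 𝔤) (c₁ c₂ : ℂ)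
    (B : Type*) [CommRing B] [Algebra ℂ B] [Algebra.FiniteType ℂ B]
    (V : Type*) [AddCommGroup V] [Module ℂ V]
    [LieRingModule (FullToroidal.TauB ν Φ c₁ c₂ B) V]
    [LieModule ℂ (FullToroidal.TauB ν Φ c₁ c₂ B) V]
    (hirr : LieModule.IsIrreducible ℂ (FullToroidal.TauB ν Φ c₁ c₂ B) V)
    (hfin : FullToroidal.IsCfin H ν Φ c₁ c₂ B V)
    (hzero : ∀ (i : Fin (ν + 1)) (v : V), ⁅FullToroidal.kt ν Φ c₁ c₂ 0 i (1 : B), v⁆ = 0)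
    (hne : ∃ (x : 𝔤) (m : FullToroidal.Deg ν) (b : B) (v : V),
      ⁅FullToroidal.xt ν Φ c₁ c₂ x m b, v⁆ ≠ 0) :
    ∃ ψ : B →ₐ[ℂ] ℂ,
      (∀ h ∈ H, ∀ (m : FullToroidal.Deg ν) (b : B),
        ∀ v ∈ FullToroidal.topSpace ν Φ c₁ c₂ B V base,
          ⁅FullToroidal.xt ν Φ c₁ c₂ h m b, v⁆ = ψ b • ⁅FullToroidal.xt ν Φ c₁ c₂ h m (1 : B), v⁆) ∧
      (∀ α, base.IsPos α → ∀ x ∈ LieAlgebra.rootSpace H (-α.1 : H → ℂ),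
        ∀ (m : FullToroidal.Deg ν) (b : B),
        ∀ v ∈ FullToroidal.topSpace ν Φ c₁ c₂ B V base,
          ⁅FullToroidal.xt ν Φ c₁ c₂ x m b, v⁆ =
            ψ b • ⁅FullToroidal.xt ν Φ c₁ c₂ x m (1 : B), v⁆) := by
  by_cases hT : topSpace ν Φ c₁ c₂ B V base = ⊥
  -- With `T = 0` any `ψ` works, but one must exist; over the zero ring every `x ⊗ t^m ⊗ b` would be
  -- zero, contradicting the nontrivial action.
  · have : Nontrivial B := by
      by_contra hB
      rw [not_nontrivial_iff_subsingleton] at hB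
      obtain ⟨x, m, b, v, h⟩ := hne
      apply h
      rw [Subsingleton.elim b (b + b), xt_add_right, Subsingleton.elim b ((0 : ℂ) • b),
        xt_smul_right, zero_smul, add_zero, zero_lie]
    obtain ⟨ψ⟩ := exists_algHom B
    refine ⟨ψ, fun h _ m b v hv => ?_, fun α _ x _ m b v hv => ?_⟩ <;>
    · rw [hT, Submodule.mem_bot] at hv
      rw [hv, lie_zero, lie_zero, smul_zero]
  obtain ⟨E, hE⟩ := exists_isTop hirr hfin hT
  obtain ⟨Λ, v₀, hv₀E, hv₀, hv₀0⟩ := exists_weight_vector hfin hE.stable hE.ne_bot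
  have hv₀' := mem_weightSpace_iff.mp hv₀
  set lam : Module.Dual ℂ H := Λ.comp (LinearMap.inl ℂ H _) with hlamdef
  have hlam : ∀ h : H, ∀ v ∈ E, ⁅xt ν Φ c₁ c₂ (h : 𝔤) 0 (1 : B), v⁆ = lam h • v := by
    intro h v hv
    obtain ⟨c, hc⟩ := hE.exists_scalar_xt hfin h.2 1
    rw [hc v hv, smul_left_injective ℂ hv₀0 ((hc v₀ hv₀E).symm.trans (hv₀'.1 h))]
    rfl
  have h0 : lam ≠ 0 := by
    intro h
    obtain ⟨x, m, b, v, hx⟩ := hne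
    exact hx (hE.lie_xt_eq_zero hirr hfin hzero (fun h' v hv => by rw [hlam h' v hv, h]; simp)
      x m b v)
  set μ : Fin (ν + 1) → ℂ := fun i => Λ (0, 0, Pi.single i 1) with hμ
  have hsup : ⨆ m, gradedPiece ν Φ c₁ c₂ B E μ m = E := by
    refine le_antisymm (iSup_le fun m => gradedPiece_le m)
      (hE.irred _ (isZeroStable_iSup_gradedPiece hE.stable) fun h => hv₀0 ?_)
    have h1 : v₀ ∈ gradedPiece ν Φ c₁ c₂ B E μ 0 := ⟨hv₀E, fun i => by
      rw [hv₀'.2.2 i]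
      simp [hμ]⟩
    have : v₀ ∈ (⨆ m, gradedPiece ν Φ c₁ c₂ B E μ m) ⊓ E :=
      ⟨Submodule.mem_iSup_of_mem 0 h1, hv₀E⟩
    rw [h] at this
    simpa using this
  obtain ⟨N, hbd⟩ := hE.exists_finrank_le hfin hzero hlam h0 μ
  have hK := lie_kt_eq_zero hirr fun p => by
    obtain ⟨v, -, hv⟩ := hE.exists_ne_zero_lie_kt_eq_zero hν hzero hsup hbd hlam h0 p
    exact ⟨v, hv⟩
  obtain ⟨ψ, hψ⟩ := hE.exists_character hfin hsup hbd hlam h0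
  have hker := fun (x : 𝔤) (m : Deg ν) {j : B} (hj : ψ j = 0) (v : V) =>
    hE.lie_xt_ker_eq_zero hirr hK
      (fun h hh n j hj => hE.lie_cartan_eq_zero hK hsup hbd hlam h0 hψ hh n hj) x m hj v
  have key : ∀ (x : 𝔤) (m : Deg ν) (b : B) (v : V),
      ⁅xt ν Φ c₁ c₂ x m b, v⁆ = ψ b • ⁅xt ν Φ c₁ c₂ x m (1 : B), v⁆ := by
    intro x m b v
    -- The projection of `b` to `ker ψ`; the identity holds on all of `V`, for all `x ∈ 𝔤`.
    have h1 := hker x m (j := b - ψ b • (1 : B)) (by simp) v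
    rwa [xt_sub_right, xt_smul_right, sub_lie, tauB_smul_lie, sub_eq_zero] at h1
  exact ⟨ψ, fun h _ m b v _ => key h m b v, fun α _ x _ m b v _ => key x m b v⟩
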